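/- Let $m,\hbar,c>0$ and $q,B\in\mathbb R$. Let $a,b\in\mathbb R^2$ with $a_1b_2-a_2b_1>0$, let $\Gamma=\{n_1a+n_2b: n_1,n_2\in\mathbb Z\}$ and $M_\Gamma=\{l_1a+l_2b: l_1,l_2\in[0,1]\}$. For $n\in\mathbb N\cup\{\infty\}$ let $C^n_{\mathrm b}(\mathbb R^2,\mathbb R)$ be the space of real functions of class $C^n$ whose derivatives of all orders $\le n$ (order $0$ included) are bounded. Assume: * ($\mathrm A_{\mathrm w}$) $A_\Gamma:\mathbb R^2\to\mathbb R^2$ and $V_\Gamma:\mathbb R^2\to\mathbb R$ are $\Gamma$-periodic, the components of $A_\Gamma$ are in $C^1_{\mathrm b}(\mathbb R^2,\mathbb R)$, and $\int_{M_\Gamma}|V_\Gamma(r)|^2\,d^2r<\infty$; * ($\mathrm B$) $\Phi\in C^\infty_{\mathrm b}(\mathbb R^2,\mathbb R)$, and $A=A_0+A_B$, where the components of $A_0$ are in $C^\infty_{\mathrm b}(\mathbb R^2,\mathbb R)$ and $A_B(r)=\left(-\tfrac B2 r_2,\tfrac B2 r_1\right)$. Consider in $L^2(\mathbb R^2)$,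 on the domain $C^\infty_{\mathrm c}(\mathbb R^2,\mathbb C)$, the Bloch–Landau Hamiltonian $$H_{\mathrm{BL}}=\frac1{2m}\Big[-i\hbar\nabla-\frac qcA_\Gamma-\frac qcA\Big]^2+V_\Gamma+q\,\Phi$$ and the periodic Hamiltonian $$H_{\mathrm{per}}=\frac1{2m}\Big[-i\hbar\nabla-\frac qcA_\Gamma\Big]^2+V_\Gamma .$$ Then $H_{\mathrm{BL}}$ and $H_{\mathrm{per}}$ are both essentially self-adjoint on $C^\infty_{\mathrm c}(\mathbb R^2,\mathbb C)$. The domain of the (self-adjoint) closure of $H_{\mathrm{per}}$ is the Sobolev space $$H^2(\mathbb R^2)=\{\psi\in L^2(\mathbb R^2):\ \partial_1^{n_1}\partial_2^{n_2}\psi\in L^2(\mathbb R^2)\text{ for all } n_1,n_2\in\mathbb N,\ n_1+n_2\le2\},$$ and the domain of the closure of $H_{\mathrm{BL}}$ is the magnetic Sobolev space $$H^2_{\mathrm M}(\mathbb R^2)=\{\psi\in L^2(\mathbb R^2):\ D_1^{n_1}D_2^{n_2}\psi\in L^2(\mathbb R^2)\text{ for all } n_1,n_2\in\mathbb N,\ n_1+n_2\le2\},$$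 with derivatives in the sense of distributions, where $D_1=\partial_1+\tfrac{i\beta}2r_2$, $D_2=\partial_2-\tfrac{i\beta}2r_1$ and $\beta=\dfrac{qB}{c\hbar}$. -/

import Mathlib

open MeasureTheory
open scoped ContDiff SchwartzMap LineDeriv

namespace BlochLandau

/-- The plane `ℝ²` with its Euclidean structure and Lebesgue measure. -/
abbrev Plane : Type := EuclideanSpace ℝ (Fin 2)

/-- The Hilbert space `L²(ℝ², ℂ)`. -/
abbrev L2 : Type := Lp ℂ 2 (volume : Measure Plane)

/-- The standard basis vector `e_j` of `ℝ²`. -/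
noncomputable abbrev e (j : Fin 2) : Plane := EuclideanSpace.single j (1 : ℝ)

/-! ### Lattices and periodic functions -/

/-- The lattice vector `n₁ a + n₂ b`. -/
def latticeVec (a b : Plane) (n : ℤ × ℤ) : Plane := n.1 • a + n.2 • b

/-- `f` is periodic with respect to the lattice generated by `a` and `b`. -/
def IsLatticePeriodic {α : Type*} (a b : Plane) (f : Plane → α) : Prop :=
  ∀ (n : ℤ × ℤ) (r : Plane), f (r + latticeVec a b n) = f r

/-- The fundamental cell `{l₁ a + l₂ b : l₁, l₂ ∈ [0, 1]}`. -/
def cell (a b : Plane) : Set Plane :=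
  {r | ∃ l₁ ∈ Set.Icc (0 : ℝ) 1, ∃ l₂ ∈ Set.Icc (0 : ℝ) 1, r = l₁ • a + l₂ • b}

/-- The oriented area `a ∧ b = a₁ b₂ - a₂ b₁`. -/
def wedge (a b : Plane) : ℝ := a 0 * b 1 - a 1 * b 0

/-! ### Assumptions on the potentials -/

/-- The class `C^n_b(ℝ², ℝ)`: real functions of class `C^n` whose derivatives of every order up to
`n` (order zero included) are bounded. -/
def IsCb (n : ℕ∞) (f : Plane → ℝ) : Prop :=
  ContDiff ℝ n f ∧ ∀ k : ℕ, (k : ℕ∞) ≤ n → ∃ C : ℝ, ∀ x, ‖iteratedFDeriv ℝ k f x‖ ≤ C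

/-- Internal potentials, weak form: `A_Γ` and `V_Γ` are periodic, the components of `A_Γ` are of
class `C^1_b`, and `V_Γ` is square integrable over the fundamental cell. -/
structure InternalWeak (a b : Plane) (AΓ : Plane → Plane) (VΓ : Plane → ℝ) : Prop where
  periodic_A : IsLatticePeriodic a b AΓ
  periodic_V : IsLatticePeriodic a b VΓ
  cb_A : ∀ j, IsCb 1 (fun r => AΓ r j)
  memLp_V : MemLp VΓ 2 (volume.restrict (cell a b))

/-- External potentials: `Φ` and the components of `A₀` are of class `C^∞_b`. -/
structure External (A₀ : Plane → Plane) (Φ : Plane → ℝ) : Prop where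
  cb_A : ∀ j, IsCb ⊤ (fun r => A₀ r j)
  cb_Φ : IsCb ⊤ Φ

/-- The vector potential `A_B(r) = (-B r₂ / 2, B r₁ / 2)` of a uniform magnetic field, in the
symmetric gauge. -/
noncomputable def uniformPotential (B : ℝ) (r : Plane) : Plane :=
  !₂[-(B / 2) * r 1, B / 2 * r 0]

/-! ### Schrödinger operators on smooth compactly supported functions -/

/-- The space `C^∞_c(ℝ², ℂ)`. -/
def testFunctions : Submodule ℂ (Plane → ℂ) where
  carrier := {φ | ContDiff ℝ ∞ φ ∧ HasCompactSupport φ}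
  zero_mem' := ⟨contDiff_const, HasCompactSupport.zero⟩
  add_mem' h h' := ⟨h.1.add h'.1, h.2.add h'.2⟩
  smul_mem' c _ h := ⟨contDiff_const.smul h.1, h.2.smul_left (f := fun _ => c)⟩

/-- The `j`-th component of `-i ħ ∇ - κ A`, acting on functions. -/
noncomputable def momentum (ħ κ : ℝ) (A : Plane → Plane) (j : Fin 2) (φ : Plane → ℂ) :
    Plane → ℂ :=
  fun r => -Complex.I * (ħ : ℂ) * fderiv ℝ φ r (e j) - (κ : ℂ) * (A r j : ℂ) * φ r

/-- The differential expression `(1 / 2m) (-i ħ ∇ - κ A)² φ + V φ`. -/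
noncomputable def hamiltonianExpr (m ħ κ : ℝ) (A : Plane → Plane) (V : Plane → ℝ)
    (φ : Plane → ℂ) : Plane → ℂ :=
  fun r => (1 / (2 * (m : ℂ))) * ∑ j, momentum ħ κ A j (momentum ħ κ A j φ) r + (V r : ℂ) * φ r

/-- `V` is locally square integrable. -/
def IsLocallyL2 (V : Plane → ℝ) : Prop :=
  ∀ K : Set Plane, IsCompact K → MemLp V 2 (volume.restrict K)

lemma momentum_contDiff {n k : ℕ∞} (hk : k + 1 ≤ n) {ħ κ : ℝ} {A : Plane → Plane} {j : Fin 2}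
    (hA : ContDiff ℝ k (fun r => A r j)) {φ : Plane → ℂ} (hφ : ContDiff ℝ n φ) :
    ContDiff ℝ k (momentum ħ κ A j φ) := by
  have h1 : ContDiff ℝ k (fderiv ℝ φ) := hφ.fderiv_right (by exact_mod_cast hk)
  have h2 : ContDiff ℝ k φ := hφ.of_le (by exact_mod_cast le_trans le_self_add hk)
  have h3 : ContDiff ℝ k (fun r => (A r j : ℂ)) := Complex.ofRealCLM.contDiff.comp hA
  unfold momentum
  exact (contDiff_const.mul (h1.clm_apply contDiff_const)).sub ((contDiff_const.mul h3).mul h2)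

lemma momentum_hasCompactSupport {ħ κ : ℝ} {A : Plane → Plane} {j : Fin 2} {φ : Plane → ℂ}
    (hφ : HasCompactSupport φ) : HasCompactSupport (momentum ħ κ A j φ) := by
  have h1 : HasCompactSupport (fun r => fderiv ℝ φ r (e j)) := hφ.fderiv_apply (𝕜 := ℝ) (e j)
  exact (h1.mul_left (f := fun _ => -Complex.I * (ħ : ℂ))).sub
    (hφ.mul_left (f := fun r => (κ : ℂ) * (A r j : ℂ)))

lemma momentum_add {ħ κ : ℝ} {A : Plane → Plane} {j : Fin 2} {φ ψ : Plane → ℂ}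
    (hφ : Differentiable ℝ φ) (hψ : Differentiable ℝ ψ) :
    momentum ħ κ A j (φ + ψ) = momentum ħ κ A j φ + momentum ħ κ A j ψ := by
  funext r
  simp only [momentum, Pi.add_apply, fderiv_add (hφ r) (hψ r), add_apply]
  ring

lemma momentum_smul {ħ κ : ℝ} {A : Plane → Plane} {j : Fin 2} (c : ℂ) {φ : Plane → ℂ}
    (hφ : Differentiable ℝ φ) :
    momentum ħ κ A j (c • φ) = c • momentum ħ κ A j φ := by
  funext r
  have h : fderiv ℝ (c • φ) r = c • fderiv ℝ φ r := fderiv_const_smul (hφ r) c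
  simp only [momentum, Pi.smul_apply, h, smul_apply, smul_eq_mul]
  ring

section Expression

variable {m ħ κ : ℝ} {A : Plane → Plane} {V : Plane → ℝ}

lemma momentum_differentiable (hA : ∀ j, ContDiff ℝ 1 (fun r => A r j)) {φ : Plane → ℂ}
    (hφ : ContDiff ℝ ∞ φ) (j : Fin 2) : Differentiable ℝ (momentum ħ κ A j φ) := by
  have h : ContDiff ℝ ((1 : ℕ∞) : WithTop ℕ∞) (momentum ħ κ A j φ) :=
    momentum_contDiff (n := ⊤) le_top (by exact_mod_cast hA j) hφ
  exact h.differentiable (by simp)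

lemma hamiltonianExpr_add (hA : ∀ j, ContDiff ℝ 1 (fun r => A r j)) {φ ψ : Plane → ℂ}
    (hφ : ContDiff ℝ ∞ φ) (hψ : ContDiff ℝ ∞ ψ) :
    hamiltonianExpr m ħ κ A V (φ + ψ) =
      hamiltonianExpr m ħ κ A V φ + hamiltonianExpr m ħ κ A V ψ := by
  funext r
  have h (j : Fin 2) := momentum_add (ħ := ħ) (κ := κ) (A := A) (j := j)
    (hφ.differentiable (by simp)) (hψ.differentiable (by simp))
  have h' (j : Fin 2) := momentum_add (ħ := ħ) (κ := κ) (A := A) (j := j)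
    (momentum_differentiable (ħ := ħ) (κ := κ) hA hφ j)
    (momentum_differentiable (ħ := ħ) (κ := κ) hA hψ j)
  simp only [hamiltonianExpr, h, h', Pi.add_apply, Finset.sum_add_distrib]
  ring

lemma hamiltonianExpr_smul (hA : ∀ j, ContDiff ℝ 1 (fun r => A r j)) (c : ℂ) {φ : Plane → ℂ}
    (hφ : ContDiff ℝ ∞ φ) :
    hamiltonianExpr m ħ κ A V (c • φ) = c • hamiltonianExpr m ħ κ A V φ := by
  funext r
  have h (j : Fin 2) := momentum_smul (ħ := ħ) (κ := κ) (A := A) (j := j) c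
    (hφ.differentiable (by simp))
  have h' (j : Fin 2) := momentum_smul (ħ := ħ) (κ := κ) (A := A) (j := j) c
    (momentum_differentiable (ħ := ħ) (κ := κ) hA hφ j)
  simp only [hamiltonianExpr, h, h', Pi.smul_apply, smul_eq_mul, ← Finset.mul_sum]
  ring

lemma memLp_potential_mul (hV : IsLocallyL2 V) {φ : Plane → ℂ} (hφ : Continuous φ)
    (hc : HasCompactSupport φ) : MemLp (fun r => (V r : ℂ) * φ r) 2 (volume : Measure Plane) := by
  have hV' : MemLp (fun r => (V r : ℂ)) 2 (volume.restrict (tsupport φ)) :=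
    (hV _ hc).ofReal
  have hφ' : MemLp φ ⊤ (volume.restrict (tsupport φ)) :=
    (hφ.memLp_top_of_hasCompactSupport hc volume).restrict _
  have h : MemLp (fun r => (V r : ℂ) * φ r) 2 (volume.restrict (tsupport φ)) := hφ'.mul hV'
  have h2 := (memLp_indicator_iff_restrict (isClosed_tsupport φ).measurableSet).2 h
  rwa [Set.indicator_eq_self.2] at h2
  intro r hr
  refine subset_tsupport φ fun h0 => hr ?_
  simp [h0]

lemma memLp_hamiltonianExpr (hA : ∀ j, ContDiff ℝ 1 (fun r => A r j)) (hV : IsLocallyL2 V)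
    {φ : Plane → ℂ} (hφ : φ ∈ testFunctions) :
    MemLp (hamiltonianExpr m ħ κ A V φ) 2 (volume : Measure Plane) := by
  have h (j : Fin 2) : MemLp (momentum ħ κ A j (momentum ħ κ A j φ)) 2
      (volume : Measure Plane) := by
    have h1 : ContDiff ℝ ((1 : ℕ∞) : WithTop ℕ∞) (momentum ħ κ A j φ) :=
      momentum_contDiff (n := ⊤) le_top (by exact_mod_cast hA j) hφ.1
    have h2 : ContDiff ℝ ((0 : ℕ∞) : WithTop ℕ∞) (momentum ħ κ A j (momentum ħ κ A j φ)) :=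
      momentum_contDiff (by simp) ((hA j).of_le (by simp)) h1
    exact h2.continuous.memLp_of_hasCompactSupport
      (momentum_hasCompactSupport (momentum_hasCompactSupport hφ.2))
  have hs := (memLp_finsetSum Finset.univ fun j _ => h j).const_mul (1 / (2 * (m : ℂ)))
  exact hs.add (memLp_potential_mul hV hφ.1.continuous hφ.2)

end Expression

/-- The inclusion of `C^∞_c(ℝ², ℂ)` in `L²(ℝ², ℂ)`. -/
noncomputable def testToL2 : testFunctions →ₗ[ℂ] L2 where
  toFun φ := (φ.2.1.continuous.memLp_of_hasCompactSupport (p := 2) (μ := volume) φ.2.2).toLp φ.1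
  map_add' _ _ := rfl
  map_smul' _ _ := rfl

lemma testToL2_injective : Function.Injective testToL2 := by
  intro φ ψ h
  have h1 : φ.1 =ᵐ[volume] ψ.1 := (MemLp.toLp_eq_toLp_iff
    (φ.2.1.continuous.memLp_of_hasCompactSupport (p := 2) φ.2.2)
    (ψ.2.1.continuous.memLp_of_hasCompactSupport (p := 2) ψ.2.2)).1 h
  exact Subtype.ext ((Continuous.ae_eq_iff_eq volume φ.2.1.continuous ψ.2.1.continuous).1 h1)

/-- The map sending `φ` in `C^∞_c(ℝ², ℂ)` to the class of `(1 / 2m) (-i ħ ∇ - κ A)² φ + V φ`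
in `L²(ℝ², ℂ)`. -/
noncomputable def hamiltonianOnTest (m ħ κ : ℝ) (A : Plane → Plane) (V : Plane → ℝ)
    (hA : ∀ j, ContDiff ℝ 1 (fun r => A r j)) (hV : IsLocallyL2 V) : testFunctions →ₗ[ℂ] L2 where
  toFun φ := (memLp_hamiltonianExpr (m := m) (ħ := ħ) (κ := κ) hA hV φ.2).toLp _
  map_add' φ ψ := by
    rw [← MemLp.toLp_add]
    exact MemLp.toLp_congr _ _ (by
      rw [Submodule.coe_add, hamiltonianExpr_add hA φ.2.1 ψ.2.1])
  map_smul' c φ := by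
    rw [RingHom.id_apply, ← MemLp.toLp_const_smul]
    exact MemLp.toLp_congr _ _ (by
      rw [Submodule.coe_smul, hamiltonianExpr_smul hA c φ.2.1])

/-- The operator `(1 / 2m) (-i ħ ∇ - κ A)² + V` in `L²(ℝ², ℂ)` with domain `C^∞_c(ℝ², ℂ)`. -/
noncomputable def schrodinger (m ħ κ : ℝ) (A : Plane → Plane) (V : Plane → ℝ)
    (hA : ∀ j, ContDiff ℝ 1 (fun r => A r j)) (hV : IsLocallyL2 V) : L2 →ₗ.[ℂ] L2 where
  domain := LinearMap.range testToL2
  toFun := hamiltonianOnTest m ħ κ A V hA hV ∘ₗ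
    (LinearEquiv.ofInjective testToL2 testToL2_injective).symm.toLinearMap

/-- The defining property of `schrodinger`. -/
lemma schrodinger_apply (m ħ κ : ℝ) (A : Plane → Plane) (V : Plane → ℝ)
    (hA : ∀ j, ContDiff ℝ 1 (fun r => A r j)) (hV : IsLocallyL2 V) (φ : testFunctions) :
    schrodinger m ħ κ A V hA hV ⟨testToL2 φ, φ, rfl⟩ =
      (memLp_hamiltonianExpr (m := m) (ħ := ħ) (κ := κ) hA hV φ.2).toLp _ := by
  have : (LinearEquiv.ofInjective testToL2 testToL2_injective).symm ⟨testToL2 φ, φ, rfl⟩ = φ := by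
    rw [LinearEquiv.symm_apply_eq]; rfl
  change hamiltonianOnTest m ħ κ A V hA hV
    ((LinearEquiv.ofInjective testToL2 testToL2_injective).symm ⟨testToL2 φ, φ, rfl⟩) = _
  rw [this]; rfl

/-! ### The Bloch and Bloch–Landau Hamiltonians -/

section Periodic

variable {a b : Plane}

lemma exists_mem_cell (hab : 0 < wedge a b) (r : Plane) :
    r - latticeVec a b (⌊(r 0 * b 1 - r 1 * b 0) / wedge a b⌋,
      ⌊(a 0 * r 1 - a 1 * r 0) / wedge a b⌋) ∈ cell a b := by
  refine ⟨Int.fract ((r 0 * b 1 - r 1 * b 0) / wedge a b),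
    ⟨Int.fract_nonneg _, (Int.fract_lt_one _).le⟩,
    Int.fract ((a 0 * r 1 - a 1 * r 0) / wedge a b),
    ⟨Int.fract_nonneg _, (Int.fract_lt_one _).le⟩, ?_⟩
  have h : r = ((r 0 * b 1 - r 1 * b 0) / wedge a b) • a +
      ((a 0 * r 1 - a 1 * r 0) / wedge a b) • b := by
    have h0 := hab.ne'
    ext j
    fin_cases j <;> simp <;> field_simp <;> simp [wedge] <;> ring
  generalize (r 0 * b 1 - r 1 * b 0) / wedge a b = s at *
  generalize (a 0 * r 1 - a 1 * r 0) / wedge a b = t at *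
  simp only [latticeVec, Int.fract, sub_smul, Int.cast_smul_eq_zsmul]
  rw [h]
  abel

lemma measurableSet_cell : MeasurableSet (cell a b) := by
  have h : cell a b =
      (fun l : ℝ × ℝ => l.1 • a + l.2 • b) '' (Set.Icc (0 : ℝ) 1 ×ˢ Set.Icc (0 : ℝ) 1) := by
    ext r
    constructor
    · rintro ⟨l₁, h₁, l₂, h₂, rfl⟩
      exact ⟨(l₁, l₂), ⟨h₁, h₂⟩, rfl⟩
    · rintro ⟨⟨l₁, l₂⟩, ⟨h₁, h₂⟩, rfl⟩
      exact ⟨l₁, h₁, l₂, h₂, rfl⟩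
  rw [h]
  exact ((isCompact_Icc.prod isCompact_Icc).image (by fun_prop)).measurableSet

/-- The translate of the fundamental cell by a lattice vector. -/
def cellAt (a b : Plane) (n : ℤ × ℤ) : Set Plane := (fun r => r - latticeVec a b n) ⁻¹' cell a b

lemma memLp_cellAt {V : Plane → ℝ} (hp : IsLatticePeriodic a b V)
    (hV : MemLp V 2 (volume.restrict (cell a b))) (n : ℤ × ℤ) :
    MemLp V 2 (volume.restrict (cellAt a b n)) := by
  have h := (measurePreserving_sub_right (volume : Measure Plane)
    (latticeVec a b n)).restrict_preimage (measurableSet_cell (a := a) (b := b))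
  have h2 := hV.comp_measurePreserving h
  change MemLp V 2 (volume.restrict ((fun r => r - latticeVec a b n) ⁻¹' cell a b))
  convert h2 using 1
  funext r
  have := hp n (r - latticeVec a b n)
  rw [sub_add_cancel] at this
  exact this

lemma isLocallyL2_of_periodic (hab : 0 < wedge a b) {V : Plane → ℝ}
    (hp : IsLatticePeriodic a b V) (hV : MemLp V 2 (volume.restrict (cell a b))) :
    IsLocallyL2 V := by
  intro K hK
  obtain ⟨C₁, h₁⟩ := hK.exists_bound_of_continuousOn
    (f := fun r : Plane => (r 0 * b 1 - r 1 * b 0) / wedge a b) (by fun_prop)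
  obtain ⟨C₂, h₂⟩ := hK.exists_bound_of_continuousOn
    (f := fun r : Plane => (a 0 * r 1 - a 1 * r 0) / wedge a b) (by fun_prop)
  let s : Finset (ℤ × ℤ) := Finset.Icc ⌊-C₁⌋ ⌊C₁⌋ ×ˢ Finset.Icc ⌊-C₂⌋ ⌊C₂⌋
  have hsub : K ⊆ ⋃ n ∈ s, cellAt a b n := by
    intro r hr
    have e₁ := abs_le.1 (h₁ r hr)
    have e₂ := abs_le.1 (h₂ r hr)
    refine Set.mem_biUnion (x := (⌊(r 0 * b 1 - r 1 * b 0) / wedge a b⌋,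
      ⌊(a 0 * r 1 - a 1 * r 0) / wedge a b⌋)) ?_ (exists_mem_cell hab r)
    simp only [s, Finset.coe_product, Set.mem_prod, Finset.coe_Icc, Set.mem_Icc]
    exact ⟨⟨Int.floor_le_floor e₁.1, Int.floor_le_floor e₁.2⟩,
      Int.floor_le_floor e₂.1, Int.floor_le_floor e₂.2⟩
  refine MemLp.mono_measure (Measure.restrict_mono hsub le_rfl) ?_
  have hm : AEStronglyMeasurable V (volume.restrict (⋃ n ∈ s, cellAt a b n)) := by
    have h : AEStronglyMeasurable V (volume.restrict (⋃ n, cellAt a b n)) :=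
      AEStronglyMeasurable.iUnion fun n => (memLp_cellAt hp hV n).1
    exact h.mono_measure (Measure.restrict_mono (Set.iUnion₂_subset_iUnion _ _) le_rfl)
  rw [memLp_two_iff_integrable_sq hm]
  exact integrableOn_finset_iUnion.2 fun n _ => (memLp_cellAt hp hV n).integrable_sq

end Periodic

lemma IsLocallyL2.add {V W : Plane → ℝ} (hV : IsLocallyL2 V) (hW : IsLocallyL2 W) :
    IsLocallyL2 (fun r => V r + W r) := fun K hK => (hV K hK).add (hW K hK)

lemma isLocallyL2_of_continuous {W : Plane → ℝ} (hW : Continuous W) : IsLocallyL2 W := by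
  intro K hK
  have : IsFiniteMeasure (volume.restrict K) := ⟨by simpa using hK.measure_lt_top⟩
  obtain ⟨C, hC⟩ := hK.exists_bound_of_continuousOn hW.continuousOn
  exact MemLp.of_bound hW.aestronglyMeasurable C
    ((ae_restrict_iff' hK.measurableSet).2 (Filter.Eventually.of_forall hC))

lemma contDiff_total {a b : Plane} {AΓ A₀ : Plane → Plane} {VΓ Φ : Plane → ℝ} (B : ℝ)
    (hΓ : InternalWeak a b AΓ VΓ) (hE : External A₀ Φ) (j : Fin 2) :
    ContDiff ℝ 1 (fun r => (AΓ r + (A₀ r + uniformPotential B r)) j) := by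
  have h1 : ContDiff ℝ 1 (fun r => AΓ r j) := by exact_mod_cast (hΓ.cb_A j).1
  have h2 : ContDiff ℝ 1 (fun r => A₀ r j) := (hE.cb_A j).1.of_le (by exact_mod_cast le_top)
  have h3 : ContDiff ℝ 1 (fun r => uniformPotential B r j) := by
    fin_cases j <;> simp [uniformPotential] <;> fun_prop
  exact h1.add (h2.add h3)

/-- The periodic (Bloch) Hamiltonian `(1 / 2m) (-i ħ ∇ - (q / c) A_Γ)² + V_Γ`
with domain `C^∞_c(ℝ², ℂ)`. -/
noncomputable def periodicHamiltonian (m ħ q c : ℝ) {a b : Plane} (hab : 0 < wedge a b)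
    {AΓ : Plane → Plane} {VΓ : Plane → ℝ} (hΓ : InternalWeak a b AΓ VΓ) : L2 →ₗ.[ℂ] L2 :=
  schrodinger m ħ (q / c) AΓ VΓ (fun j => by exact_mod_cast (hΓ.cb_A j).1)
    (isLocallyL2_of_periodic hab hΓ.periodic_V hΓ.memLp_V)

/-- The Bloch–Landau Hamiltonian
`(1 / 2m) (-i ħ ∇ - (q / c) A_Γ - (q / c) (A₀ + A_B))² + V_Γ + q Φ`
with domain `C^∞_c(ℝ², ℂ)`. -/
noncomputable def blochLandauHamiltonian (m ħ q c B : ℝ) {a b : Plane} (hab : 0 < wedge a b)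
    {AΓ A₀ : Plane → Plane} {VΓ Φ : Plane → ℝ} (hΓ : InternalWeak a b AΓ VΓ)
    (hE : External A₀ Φ) : L2 →ₗ.[ℂ] L2 :=
  schrodinger m ħ (q / c) (fun r => AΓ r + (A₀ r + uniformPotential B r))
    (fun r => VΓ r + q * Φ r) (contDiff_total B hΓ hE)
    ((isLocallyL2_of_periodic hab hΓ.periodic_V hΓ.memLp_V).add
      (isLocallyL2_of_continuous (continuous_const.mul hE.cb_Φ.1.continuous)))

/-- A (densely defined) operator is essentially self-adjoint if it is closable and its closure is
self-adjoint. Density of the domain is part of self-adjointness of the closure. -/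
def IsEssentiallySelfAdjoint (T : L2 →ₗ.[ℂ] L2) : Prop :=
  T.IsClosable ∧ IsSelfAdjoint T.closure

/-! ### Sobolev spaces -/

/-- The distributional partial derivative `∂_j`. -/
noncomputable def partialD (j : Fin 2) : 𝓢'(Plane, ℂ) →L[ℂ] 𝓢'(Plane, ℂ) :=
  LineDeriv.lineDerivOpCLM ℂ 𝓢'(Plane, ℂ) (e j)

/-- The covariant derivatives `D_j = ∂_j - i (A_β)_j` on tempered distributions, where `A_β` is the
symmetric-gauge potential of strength `β`; thus `D_1 = ∂_1 + (i β / 2) x_2` and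
`D_2 = ∂_2 - (i β / 2) x_1`. -/
noncomputable def magneticD (β : ℝ) (j : Fin 2) : 𝓢'(Plane, ℂ) →L[ℂ] 𝓢'(Plane, ℂ) :=
  partialD j -
    TemperedDistribution.smulLeftCLM ℂ (fun x => Complex.I * (uniformPotential β x j : ℂ))

/-- The `ψ ∈ L²` such that the distribution `P₁^{n₁} P₂^{n₂} ψ` is in `L²` whenever
`n₁ + n₂ ≤ 2`. -/
noncomputable def sobolevOf (P : Fin 2 → 𝓢'(Plane, ℂ) →L[ℂ] 𝓢'(Plane, ℂ)) : Submodule ℂ L2 where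
  carrier := {ψ | ∀ n₁ n₂ : ℕ, n₁ + n₂ ≤ 2 →
    ∃ g : L2, (P 0 ^ n₁ * P 1 ^ n₂) (ψ : 𝓢'(Plane, ℂ)) = (g : 𝓢'(Plane, ℂ))}
  zero_mem' n₁ n₂ _ := ⟨0, by
    have h := map_zero (Lp.toTemperedDistributionCLM ℂ (volume : Measure Plane) 2)
    rw [Lp.toTemperedDistributionCLM_apply] at h
    rw [h, map_zero]⟩
  add_mem' {ψ χ} hψ hχ n₁ n₂ hn := by
    obtain ⟨g, hg⟩ := hψ n₁ n₂ hn
    obtain ⟨g', hg'⟩ := hχ n₁ n₂ hn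
    refine ⟨g + g', ?_⟩
    have h := map_add (Lp.toTemperedDistributionCLM ℂ (volume : Measure Plane) 2)
    simp only [Lp.toTemperedDistributionCLM_apply] at h
    rw [h, h, map_add, hg, hg']
  smul_mem' c ψ hψ n₁ n₂ hn := by
    obtain ⟨g, hg⟩ := hψ n₁ n₂ hn
    refine ⟨c • g, ?_⟩
    have h := map_smul (Lp.toTemperedDistributionCLM ℂ (volume : Measure Plane) 2)
    simp only [Lp.toTemperedDistributionCLM_apply] at h
    rw [h, h, map_smul, hg]

/-- The second Sobolev space `H²(ℝ²)`. -/
noncomputable def sobolevTwo : Submodule ℂ L2 := sobolevOf partialD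

/-- The second magnetic Sobolev space `H²_M(ℝ²)` for a uniform field of strength `β`. -/
noncomputable def magneticSobolevTwo (β : ℝ) : Submodule ℂ L2 := sobolevOf (magneticD β)

end BlochLandau

/-!
All operators are compared with the covariant Laplacian `L = Π₁² + Π₂²`, where
`Π_j = -i ∂_j - (A_β)_j` are the momenta in a uniform magnetic field. Since `[Π₁, Π₂]` is a
constant, expanding `‖L φ‖²` bounds every `Π_j Π_k φ` by `L φ` and `φ`, so the graph norm of `L` is
equivalent to the norm of `H²_M`. The Hamiltonians differ from `(ħ² / 2m) L` by first order terms
with bounded coefficients and by a uniformly locally square integrable potential. Both perturbations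
are infinitesimally `L`-bounded, the potential because of a Sobolev inequality on unit squares:
gauge invariance of `φ̄ φ` allows all derivatives in it to be covariant. By Kato–Rellich everything
reduces to the density of the range of `L + λ` for `λ > 0`. If `u ∈ L²` is orthogonal to that range,
its twisted convolution `v(x) = ⟨u, τ_x φ⟩` with a test function `φ` is bounded, and orthogonality
to `(L + λ) τ_x φ` makes `|v|²` a bounded subsolution, `2λ |v|² ≤ Δ |v|²`. By the maximum principle
`v = 0`, and `v(0) = 0` for all `φ` means `u = 0`.
-/

namespace BlochLandau

open Filter Topology
open scoped ComplexConjugate ENNReal NNReal InnerProductSpace BoundedContinuousFunction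

/-! ### Perturbation theory of symmetric operators -/

section Abstract

variable {𝕜 H D : Type*} [RCLike 𝕜] [NormedAddCommGroup H] [InnerProductSpace 𝕜 H]
  [AddCommGroup D] [Module 𝕜 D] {T : H →ₗ.[𝕜] H} {J K L : D →ₗ[𝕜] H}

lemma mem_closure_range_iff_exists_seq {X : Type*} [NormedAddCommGroup X] [Module 𝕜 X]
    [ContinuousConstSMul 𝕜 X] {S : D →ₗ[𝕜] X} {x : X} :
    x ∈ (LinearMap.range S).topologicalClosure ↔
      ∃ φ : ℕ → D, Tendsto (fun n => S (φ n)) atTop (𝓝 x) := by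
  rw [← SetLike.mem_coe, Submodule.topologicalClosure_coe, mem_closure_iff_seq_limit]
  constructor
  · rintro ⟨p, hp, hlim⟩
    choose φ hφ using hp
    exact ⟨φ, by simpa only [hφ] using hlim⟩
  · rintro ⟨φ, hφ⟩
    exact ⟨_, fun n => ⟨φ n, rfl⟩, hφ⟩

lemma mem_closure_graph_iff_exists_seq (hT : T.graph = LinearMap.range (J.prod K))
    (hc : T.IsClosable) {x y : H} :
    (x, y) ∈ T.closure.graph ↔ ∃ φ : ℕ → D, Tendsto (fun n => J (φ n)) atTop (𝓝 x) ∧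
      Tendsto (fun n => K (φ n)) atTop (𝓝 y) := by
  rw [← hc.graph_closure_eq_closure_graph, hT, mem_closure_range_iff_exists_seq]
  simp only [LinearMap.prod_apply, Function.prod, nhds_prod_eq, tendsto_prod_iff']

lemma mem_closure_domain_iff_exists_seq [CompleteSpace H]
    (hT : T.graph = LinearMap.range (J.prod K)) (hc : T.IsClosable) {x : H} :
    x ∈ T.closure.domain ↔ ∃ φ : ℕ → D, Tendsto (fun n => J (φ n)) atTop (𝓝 x) ∧
      CauchySeq (fun n => K (φ n)) := by
  simp only [LinearPMap.mem_domain_iff, mem_closure_graph_iff_exists_seq hT hc]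
  constructor
  · rintro ⟨y, φ, hx, hy⟩
    exact ⟨φ, hx, hy.cauchySeq⟩
  · rintro ⟨φ, hx, hK⟩
    obtain ⟨y, hy⟩ := cauchySeq_tendsto_of_complete hK
    exact ⟨y, φ, hx, hy⟩

lemma mem_adjoint_graph_iff [CompleteSpace H] (hT : Dense (T.domain : Set H)) {y w : H} :
    (y, w) ∈ T.adjoint.graph ↔ ∀ p ∈ T.graph, inner 𝕜 w p.1 = inner 𝕜 y p.2 := by
  rw [LinearPMap.adjoint_graph_eq_graph_adjoint hT, Submodule.mem_adjoint_iff]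
  refine ⟨fun h p hp => ?_, fun h u v huv => ?_⟩
  · rw [← inner_conj_symm w, ← inner_conj_symm y, ← sub_eq_zero.1 (h p.1 p.2 hp)]
  · rw [sub_eq_zero, ← inner_conj_symm v, ← inner_conj_symm u, h _ huv]

lemma closure_adjoint_eq_adjoint [CompleteSpace H] (hT : Dense (T.domain : Set H))
    (hc : T.IsClosable) : T.closure.adjoint = T.adjoint := by
  refine LinearPMap.eq_of_eq_graph (Submodule.ext fun ⟨y, w⟩ => ?_)
  rw [mem_adjoint_graph_iff (hT.mono T.le_closure.1), mem_adjoint_graph_iff hT,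
    ← hc.graph_closure_eq_closure_graph]
  refine ⟨fun h p hp => h p (Submodule.le_topologicalClosure _ hp), fun h p hp => ?_⟩
  exact closure_minimal h (isClosed_eq (by fun_prop) (by fun_prop)) hp

lemma cauchySeq_of_norm_le {φ : ℕ → D} {c₁ c₂ : ℝ}
    (h : ∀ ψ, ‖L ψ‖ ≤ c₁ * ‖K ψ‖ + c₂ * ‖J ψ‖) (hK : CauchySeq fun n => K (φ n))
    (hJ : CauchySeq fun n => J (φ n)) : CauchySeq fun n => L (φ n) := by
  rw [cauchySeq_iff_tendsto_dist_atTop_0] at hK hJ ⊢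
  refine squeeze_zero (fun _ => dist_nonneg) (fun n => ?_)
    (by simpa using (hK.const_mul c₁).add (hJ.const_mul c₂))
  simpa only [dist_eq_norm, map_sub] using h (φ n.1 - φ n.2)

lemma exists_seq_tendsto_of_forall_inner_eq [CompleteSpace H]
    (hsymm : ∀ φ ψ, inner 𝕜 (K φ) (J ψ) = inner 𝕜 (J φ) (K ψ)) {z c : ℝ}
    (hlower : ∀ φ, ‖J φ‖ ≤ c * ‖(K + (z : 𝕜) • J) φ‖)
    (hdense : DenseRange (K + (z : 𝕜) • J)) {y w : H}
    (hyw : ∀ φ, inner 𝕜 w (J φ) = inner 𝕜 y (K φ)) :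
    ∃ φ : ℕ → D, Tendsto (fun n => J (φ n)) atTop (𝓝 y) ∧
      Tendsto (fun n => K (φ n)) atTop (𝓝 w) := by
  set S := K + (z : 𝕜) • J with hS
  obtain ⟨φ, hφ⟩ := mem_closure_range_iff_exists_seq.1
    (show w + (z : 𝕜) • y ∈ (LinearMap.range S).topologicalClosure from hdense _)
  have hJcauchy : CauchySeq fun n => J (φ n) :=
    cauchySeq_of_norm_le (K := S) (J := S) (c₁ := c) (c₂ := 0) (by simpa using hlower)
      hφ.cauchySeq hφ.cauchySeq
  obtain ⟨x, hx⟩ := cauchySeq_tendsto_of_complete hJcauchy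
  have hSsymm (ψ χ : D) : inner 𝕜 (S ψ) (J χ) = inner 𝕜 (J ψ) (S χ) := by
    simp [hS, inner_add_left, inner_add_right, inner_smul_left, inner_smul_right, hsymm]
  have hxy : x = y := by
    rw [← sub_eq_zero, ← inner_self_eq_zero (𝕜 := 𝕜)]
    refine hdense.induction_on (p := fun v => inner 𝕜 (x - y) v = 0) _
      (isClosed_eq (by fun_prop) (by fun_prop)) fun ψ => ?_
    have hlim : inner 𝕜 (w + (z : 𝕜) • y) (J ψ) = inner 𝕜 x (S ψ) :=
      tendsto_nhds_unique (hφ.inner tendsto_const_nhds)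
        ((hx.inner tendsto_const_nhds).congr fun n => (hSsymm _ _).symm)
    rw [inner_sub_left, ← hlim]
    simp [hS, inner_add_left, inner_add_right, inner_smul_left, inner_smul_right, hyw]
  subst hxy
  refine ⟨φ, hx, ?_⟩
  simpa [hS] using hφ.sub (hx.const_smul (z : 𝕜))

theorem isSelfAdjoint_closure_of_denseRange [CompleteSpace H]
    (hT : T.graph = LinearMap.range (J.prod K)) (hJ : DenseRange J)
    (hsymm : ∀ φ ψ, inner 𝕜 (K φ) (J ψ) = inner 𝕜 (J φ) (K ψ)) {z c : ℝ}
    (hlower : ∀ φ, ‖J φ‖ ≤ c * ‖(K + (z : 𝕜) • J) φ‖)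
    (hdense : DenseRange (K + (z : 𝕜) • J)) :
    T.IsClosable ∧ IsSelfAdjoint T.closure := by
  have hTd : Dense (T.domain : Set H) := hJ.mono <| Set.range_subset_iff.2 fun φ =>
    LinearPMap.mem_domain_iff.2 ⟨K φ, hT ▸ ⟨φ, rfl⟩⟩
  have hadj {y w : H} : (y, w) ∈ T.adjoint.graph ↔ ∀ φ, inner 𝕜 w (J φ) = inner 𝕜 y (K φ) := by
    rw [mem_adjoint_graph_iff hTd, hT]
    exact ⟨fun h φ => h _ ⟨φ, rfl⟩, by rintro h _ ⟨φ, rfl⟩; exact h φ⟩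
  have hle : T ≤ T.adjoint := LinearPMap.le_of_le_graph <| by
    rw [hT]
    rintro _ ⟨φ, rfl⟩
    exact hadj.2 (hsymm φ)
  have hclosable : T.IsClosable := (T.adjoint_isClosed hTd).isClosable.leIsClosable hle
  refine ⟨hclosable, LinearPMap.isSelfAdjoint_def.2 ?_⟩
  rw [closure_adjoint_eq_adjoint hTd hclosable]
  refine LinearPMap.eq_of_eq_graph (le_antisymm ?_ ?_)
  · rintro ⟨y, w⟩ h
    exact (mem_closure_graph_iff_exists_seq hT hclosable).2
        (exists_seq_tendsto_of_forall_inner_eq hsymm hlower hdense (hadj.1 h))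
  · rw [← hclosable.graph_closure_eq_closure_graph]
    exact Submodule.topologicalClosure_minimal _ (LinearPMap.le_graph_of_le hle)
      (T.adjoint_isClosed hTd)

lemma denseRange_of_forall_inner_eq_zero [CompleteSpace H] {S : D →ₗ[𝕜] H}
    (h : ∀ u, (∀ φ, inner 𝕜 u (S φ) = 0) → u = 0) : DenseRange S := by
  have hperp : (LinearMap.range S)ᗮ = ⊥ := (Submodule.eq_bot_iff _).2 fun u hu =>
    h u fun φ => Submodule.inner_left_of_mem_orthogonal (LinearMap.mem_range_self S φ) hu
  exact (Submodule.dense_iff_topologicalClosure_eq_top).2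
    (Submodule.topologicalClosure_eq_top_iff.2 hperp)

lemma denseRange_of_norm_sub_le [CompleteSpace H] {S S₀ : D →ₗ[𝕜] H} {ε : ℝ} (hε : ε < 1)
    (hS₀ : DenseRange S₀) (h : ∀ φ, ‖S φ - S₀ φ‖ ≤ ε * ‖S₀ φ‖) : DenseRange S := by
  refine denseRange_of_forall_inner_eq_zero fun u hu => ?_
  have key (v : H) : ‖inner 𝕜 u v‖ ≤ ‖u‖ * (ε * ‖v‖) := by
    refine hS₀.induction_on (p := fun v => ‖inner 𝕜 u v‖ ≤ ‖u‖ * (ε * ‖v‖)) v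
      (isClosed_le (by fun_prop) (by fun_prop)) fun φ => ?_
    calc ‖inner 𝕜 u (S₀ φ)‖ = ‖inner 𝕜 u (S φ - S₀ φ)‖ := by simp [inner_sub_right, hu]
      _ ≤ ‖u‖ * ‖S φ - S₀ φ‖ := norm_inner_le_norm _ _
      _ ≤ ‖u‖ * (ε * ‖S₀ φ‖) := by gcongr; exact h φ
  have hu := key u
  rw [inner_self_eq_norm_sq_to_K, norm_pow, RCLike.norm_ofReal, abs_norm] at hu
  by_contra hne
  nlinarith [pow_pos (norm_pos_iff.2 hne) 2]

/-- `W` is infinitesimally bounded relative to `L`, for operators on the common core `D` with the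
map `J` into the Hilbert space. -/
def IsInfinitesimallyBounded (J L : D →ₗ[𝕜] H) (W : D → H) : Prop :=
  ∀ ε > 0, ∃ C, ∀ φ, ‖W φ‖ ≤ ε * ‖L φ‖ + C * ‖J φ‖

namespace IsInfinitesimallyBounded

variable {W W' : D → H}

lemma add (h : IsInfinitesimallyBounded J L W) (h' : IsInfinitesimallyBounded J L W') :
    IsInfinitesimallyBounded J L fun φ => W φ + W' φ := by
  intro ε hε
  obtain ⟨C, hC⟩ := h (ε / 2) (half_pos hε)
  obtain ⟨C', hC'⟩ := h' (ε / 2) (half_pos hε)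
  refine ⟨C + C', fun φ => ?_⟩
  linarith [norm_add_le (W φ) (W' φ), hC φ, hC' φ]

lemma sum {ι : Type*} {s : Finset ι} {W : ι → D → H}
    (h : ∀ i ∈ s, IsInfinitesimallyBounded J L (W i)) :
    IsInfinitesimallyBounded J L fun φ => ∑ i ∈ s, W i φ := by
  classical
  induction s using Finset.induction_on with
  | empty =>
    refine fun ε hε => ⟨0, fun φ => ?_⟩
    simp only [Finset.sum_empty, norm_zero]
    positivity
  | insert i s hi ih =>
    simp only [Finset.sum_insert hi]
    exact (h i (Finset.mem_insert_self i s)).add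
      (ih fun j hj => h j (Finset.mem_insert_of_mem hj))

lemma of_norm_le {a b : ℝ} (hW' : IsInfinitesimallyBounded J L W')
    (h : ∀ φ, ‖W φ‖ ≤ a * ‖W' φ‖ + b * ‖J φ‖) : IsInfinitesimallyBounded J L W := by
  intro ε hε
  obtain ⟨C, hC⟩ := hW' (ε / (|a| + 1)) (by positivity)
  refine ⟨|a| * C + b, fun φ => ?_⟩
  have hle : |a| * (ε / (|a| + 1)) ≤ ε := by
    rw [← mul_div_assoc, div_le_iff₀ (by positivity)]; nlinarith
  calc ‖W φ‖ ≤ a * ‖W' φ‖ + b * ‖J φ‖ := h φ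
    _ ≤ |a| * (ε / (|a| + 1) * ‖L φ‖ + C * ‖J φ‖) + b * ‖J φ‖ := by
      gcongr
      exacts [le_abs_self a, hC φ]
    _ = |a| * (ε / (|a| + 1)) * ‖L φ‖ + (|a| * C + b) * ‖J φ‖ := by ring
    _ ≤ ε * ‖L φ‖ + (|a| * C + b) * ‖J φ‖ := by gcongr

lemma of_sq_le (h : ∀ ε > 0, ∃ C, ∀ φ, ‖W φ‖ ^ 2 ≤ ε * ‖L φ‖ ^ 2 + C * ‖J φ‖ ^ 2) :
    IsInfinitesimallyBounded J L W := by
  intro ε hε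
  obtain ⟨C, hC⟩ := h (ε ^ 2) (by positivity)
  refine ⟨√|C|, fun φ => abs_le_of_sq_le_sq' ?_ (by positivity) |>.2⟩
  calc ‖W φ‖ ^ 2 ≤ ε ^ 2 * ‖L φ‖ ^ 2 + |C| * ‖J φ‖ ^ 2 :=
        (hC φ).trans (by gcongr; exact le_abs_self C)
    _ ≤ (ε * ‖L φ‖ + √|C| * ‖J φ‖) ^ 2 := by
      have : 0 ≤ ε * ‖L φ‖ * (√|C| * ‖J φ‖) := by positivity
      nlinarith [Real.sq_sqrt (abs_nonneg C)]

end IsInfinitesimallyBounded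

section Nonneg

variable (hL : ∀ φ, 0 ≤ RCLike.re (inner 𝕜 (L φ) (J φ)))
include hL

lemma norm_sq_add_norm_sq_le_norm_add_smul_sq {l : ℝ} (hl : 0 ≤ l) (φ : D) :
    ‖L φ‖ ^ 2 + (l * ‖J φ‖) ^ 2 ≤ ‖(L + (l : 𝕜) • J) φ‖ ^ 2 := by
  have hre : RCLike.re (inner 𝕜 (L φ) ((l : 𝕜) • J φ)) = l * RCLike.re (inner 𝕜 (L φ) (J φ)) := by
    rw [inner_smul_right, RCLike.re_ofReal_mul]
  rw [LinearMap.add_apply, LinearMap.smul_apply, norm_add_sq (𝕜 := 𝕜), hre, norm_smul,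
    RCLike.norm_ofReal, abs_of_nonneg hl]
  linarith [mul_nonneg hl (hL φ)]

lemma norm_le_norm_add_smul {l : ℝ} (hl : 0 ≤ l) (φ : D) :
    ‖L φ‖ ≤ ‖(L + (l : 𝕜) • J) φ‖ :=
  abs_le_of_sq_le_sq' (by nlinarith [norm_sq_add_norm_sq_le_norm_add_smul_sq hL hl φ])
    (norm_nonneg _) |>.2

lemma mul_norm_le_norm_add_smul {l : ℝ} (hl : 0 ≤ l) (φ : D) :
    l * ‖J φ‖ ≤ ‖(L + (l : 𝕜) • J) φ‖ :=
  abs_le_of_sq_le_sq' (by nlinarith [norm_sq_add_norm_sq_le_norm_add_smul_sq hL hl φ])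
    (norm_nonneg _) |>.2

lemma exists_norm_add_smul_sub_smul_add_smul_le {c : ℝ} (hc : c ≠ 0)
    (hKL : IsInfinitesimallyBounded J L fun φ => K φ - (c : 𝕜) • L φ) :
    ∃ l > 0, ∀ φ, ‖(K + ((c * l : ℝ) : 𝕜) • J) φ - ((c : 𝕜) • (L + (l : 𝕜) • J)) φ‖ ≤
      1 / 2 * ‖((c : 𝕜) • (L + (l : 𝕜) • J)) φ‖ := by
  have hc' : 0 < |c| := abs_pos.2 hc
  obtain ⟨C, hC⟩ := hKL (|c| / 4) (by positivity)
  have hl : 0 < 4 * |C| / |c| + 1 := by positivity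
  refine ⟨_, hl, fun φ => ?_⟩
  set l : ℝ := 4 * |C| / |c| + 1 with hl_def
  have hCl : C ≤ |c| / 4 * l := by
    have : |c| / 4 * l = |C| + |c| / 4 := by rw [hl_def]; field_simp
    linarith [le_abs_self C]
  have heq : (K + ((c * l : ℝ) : 𝕜) • J) φ - ((c : 𝕜) • (L + (l : 𝕜) • J)) φ =
      K φ - (c : 𝕜) • L φ := by
    simp only [LinearMap.add_apply, LinearMap.smul_apply, RCLike.ofReal_mul, mul_smul, smul_add]
    abel
  rw [heq, LinearMap.smul_apply, norm_smul, RCLike.norm_ofReal]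
  calc ‖K φ - (c : 𝕜) • L φ‖ ≤ |c| / 4 * ‖L φ‖ + C * ‖J φ‖ := hC φ
    _ ≤ |c| / 4 * ‖L φ‖ + |c| / 4 * l * ‖J φ‖ := by gcongr
    _ = |c| / 4 * (‖L φ‖ + l * ‖J φ‖) := by ring
    _ ≤ |c| / 4 * (‖(L + (l : 𝕜) • J) φ‖ + ‖(L + (l : 𝕜) • J) φ‖) := by
      gcongr
      exacts [norm_le_norm_add_smul hL hl.le φ, mul_norm_le_norm_add_smul hL hl.le φ]
    _ = 1 / 2 * (|c| * ‖(L + (l : 𝕜) • J) φ‖) := by ring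

/-- The Kato–Rellich theorem, for a perturbation of a multiple of a nonnegative operator. -/
theorem isSelfAdjoint_closure_of_isInfinitesimallyBounded [CompleteSpace H]
    (hT : T.graph = LinearMap.range (J.prod K)) (hJ : DenseRange J)
    (hsymm : ∀ φ ψ, inner 𝕜 (K φ) (J ψ) = inner 𝕜 (J φ) (K ψ))
    (hdense : ∀ l : ℝ, 0 < l → DenseRange (L + (l : 𝕜) • J)) {c : ℝ} (hc : c ≠ 0)
    (hKL : IsInfinitesimallyBounded J L fun φ => K φ - (c : 𝕜) • L φ) :
    T.IsClosable ∧ IsSelfAdjoint T.closure := by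
  obtain ⟨l, hl, hsub⟩ := exists_norm_add_smul_sub_smul_add_smul_le hL hc hKL
  set S₀ : D →ₗ[𝕜] H := (c : 𝕜) • (L + (l : 𝕜) • J) with hS₀
  have hS₀dense : DenseRange S₀ :=
    (Homeomorph.smulOfNeZero (c : 𝕜) (by exact_mod_cast hc)).surjective.denseRange.comp
      (hdense l hl) (continuous_const_smul _)
  have hS₀J (φ : D) : |c| * l * ‖J φ‖ ≤ ‖S₀ φ‖ := by
    rw [hS₀, LinearMap.smul_apply, norm_smul, RCLike.norm_ofReal, mul_assoc]
    gcongr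
    exact mul_norm_le_norm_add_smul hL hl.le φ
  have hlower (φ : D) : ‖J φ‖ ≤ 2 / (|c| * l) * ‖(K + ((c * l : ℝ) : 𝕜) • J) φ‖ := by
    have := norm_sub_norm_le (S₀ φ) ((K + ((c * l : ℝ) : 𝕜) • J) φ)
    rw [norm_sub_rev] at this
    rw [div_mul_eq_mul_div, le_div_iff₀ (by positivity)]
    linarith [hsub φ, hS₀J φ]
  exact isSelfAdjoint_closure_of_denseRange hT hJ hsymm hlower
    (denseRange_of_norm_sub_le (by norm_num) hS₀dense hsub)

end Nonneg

lemma cauchySeq_iff_of_isInfinitesimallyBounded {c : 𝕜} (hc : c ≠ 0)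
    (hKL : IsInfinitesimallyBounded J L fun φ => K φ - c • L φ) {φ : ℕ → D}
    (hJ : CauchySeq fun n => J (φ n)) :
    (CauchySeq fun n => K (φ n)) ↔ CauchySeq fun n => L (φ n) := by
  obtain ⟨C, hC⟩ := hKL (‖c‖ / 2) (by positivity)
  refine ⟨fun hK => cauchySeq_of_norm_le (c₁ := 2 / ‖c‖) (c₂ := 2 / ‖c‖ * C) (fun ψ => ?_) hK hJ,
    fun hL => cauchySeq_of_norm_le (c₁ := 3 / 2 * ‖c‖) (c₂ := C) (fun ψ => ?_) hL hJ⟩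
  · have hle := norm_sub_norm_le (c • L ψ) (K ψ)
    rw [norm_sub_rev, norm_smul] at hle
    have : ‖c‖ / 2 * ‖L ψ‖ ≤ ‖K ψ‖ + C * ‖J ψ‖ := by linarith [hC ψ]
    calc ‖L ψ‖ = 2 / ‖c‖ * (‖c‖ / 2 * ‖L ψ‖) := by field_simp
      _ ≤ 2 / ‖c‖ * (‖K ψ‖ + C * ‖J ψ‖) := by gcongr
      _ = _ := by ring
  · have hle := norm_sub_norm_le (K ψ) (c • L ψ)
    rw [norm_smul] at hle
    linarith [hC ψ]

end Abstract

/-! ### Symmetric operators with a constant commutator -/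

section Commutator

variable {H D : Type*} [NormedAddCommGroup H] [InnerProductSpace ℂ H]
  [AddCommGroup D] [Module ℂ D] {J : D →ₗ[ℂ] H} {P Q : D →ₗ[ℂ] D}
  (hP : ∀ φ ψ, inner ℂ (J (P φ)) (J ψ) = inner ℂ (J φ) (J (P ψ)))
  (hQ : ∀ φ ψ, inner ℂ (J (Q φ)) (J ψ) = inner ℂ (J φ) (J (Q ψ)))
include hP hQ

lemma inner_sq_add_sq_self (φ : D) :
    inner ℂ (J (P (P φ) + Q (Q φ))) (J φ) = ((‖J (P φ)‖ ^ 2 + ‖J (Q φ)‖ ^ 2 : ℝ) : ℂ) := by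
  rw [map_add, inner_add_left, hP _ φ, hQ _ φ, inner_self_eq_norm_sq_to_K,
    inner_self_eq_norm_sq_to_K]
  push_cast
  rfl

lemma norm_sq_add_norm_sq_le (φ : D) :
    ‖J (P φ)‖ ^ 2 + ‖J (Q φ)‖ ^ 2 ≤ ‖J φ‖ * ‖J (P (P φ) + Q (Q φ))‖ := by
  have h := norm_inner_le_norm (𝕜 := ℂ) (J (P (P φ) + Q (Q φ))) (J φ)
  rw [inner_sq_add_sq_self hP hQ, Complex.norm_real, mul_comm] at h
  exact (le_abs_self _).trans h

variable {β : ℝ} (hPQ : ∀ φ, P (Q φ) - Q (P φ) = (Complex.I * β) • φ)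
include hPQ

lemma inner_sq_sq (φ : D) :
    inner ℂ (J (P (P φ))) (J (Q (Q φ))) =
      (‖J (Q (P φ))‖ : ℂ) ^ 2 + 2 * β * (Complex.I * inner ℂ (J (P φ)) (J (Q φ))) := by
  have hPQ' (χ : D) : J (P (Q χ)) = J (Q (P χ)) + (Complex.I * β) • J χ := by
    rw [← map_smul, ← map_add, ← hPQ, add_sub_cancel]
  calc inner ℂ (J (P (P φ))) (J (Q (Q φ)))
      = inner ℂ (J (P φ)) (J (P (Q (Q φ)))) := hP _ _
    _ = inner ℂ (J (P φ)) (J (Q (P (Q φ)))) +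
          Complex.I * β * inner ℂ (J (P φ)) (J (Q φ)) := by
      rw [hPQ', inner_add_right, inner_smul_right]
    _ = inner ℂ (J (Q (P φ))) (J (P (Q φ))) +
          Complex.I * β * inner ℂ (J (P φ)) (J (Q φ)) := by rw [hQ]
    _ = inner ℂ (J (Q (P φ))) (J (Q (P φ))) +
          2 * β * (Complex.I * inner ℂ (J (P φ)) (J (Q φ))) := by
      rw [hPQ', inner_add_right, inner_smul_right, hQ (P φ) φ]
      ring
    _ = _ := by rw [inner_self_eq_norm_sq_to_K]; rfl

lemma norm_sq_second_order_le (φ : D) :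
    ‖J (P (P φ))‖ ^ 2 + ‖J (Q (Q φ))‖ ^ 2 + 2 * ‖J (Q (P φ))‖ ^ 2 ≤
      (‖J (P (P φ) + Q (Q φ))‖ + |β| * ‖J φ‖) ^ 2 := by
  have hre : RCLike.re (inner ℂ (J (P (P φ))) (J (Q (Q φ)))) =
      ‖J (Q (P φ))‖ ^ 2 - 2 * (β * (inner ℂ (J (P φ)) (J (Q φ))).im) := by
    rw [inner_sq_sq hP hQ hPQ]
    norm_cast
    simp [-Complex.ofReal_pow, mul_assoc, sub_eq_add_neg]
  have him : β * (inner ℂ (J (P φ)) (J (Q φ))).im ≤ |β| * (‖J (P φ)‖ * ‖J (Q φ)‖) :=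
    calc β * (inner ℂ (J (P φ)) (J (Q φ))).im
        ≤ |β| * |(inner ℂ (J (P φ)) (J (Q φ))).im| := (le_abs_self _).trans (abs_mul _ _).le
      _ ≤ |β| * (‖J (P φ)‖ * ‖J (Q φ)‖) := by
        gcongr
        exact (Complex.abs_im_le_norm _).trans (norm_inner_le_norm _ _)
  have hsum := norm_sq_add_norm_sq_le hP hQ φ
  have hsq : ‖J (P (P φ) + Q (Q φ))‖ ^ 2 = ‖J (P (P φ))‖ ^ 2 +
      2 * (‖J (Q (P φ))‖ ^ 2 - 2 * (β * (inner ℂ (J (P φ)) (J (Q φ))).im)) +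
        ‖J (Q (Q φ))‖ ^ 2 := by
    rw [map_add, norm_add_sq (𝕜 := ℂ), hre]
  have hmul : 2 * (|β| * (‖J (P φ)‖ * ‖J (Q φ)‖)) ≤
      |β| * (‖J φ‖ * ‖J (P (P φ) + Q (Q φ))‖) := by
    rw [mul_left_comm]
    refine mul_le_mul_of_nonneg_left ?_ (abs_nonneg β)
    nlinarith [sq_nonneg (‖J (P φ)‖ - ‖J (Q φ)‖)]
  nlinarith [sq_nonneg (|β| * ‖J φ‖)]

end Commutator

/-! ### Momentum operators on test functions -/

lemma inner_toLp {f g : Plane → ℂ} (hf : MemLp f 2 (volume : Measure Plane))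
    (hg : MemLp g 2 (volume : Measure Plane)) :
    inner ℂ (hf.toLp f) (hg.toLp g) = ∫ r, conj (f r) * g r := by
  rw [L2.inner_def]
  refine integral_congr_ae ?_
  filter_upwards [hf.coeFn_toLp, hg.coeFn_toLp] with r h₁ h₂
  rw [h₁, h₂, RCLike.inner_apply, mul_comm]

lemma fderiv_conj_apply {E : Type*} [NormedAddCommGroup E] [NormedSpace ℝ E] (φ : E → ℂ)
    (r v : E) : fderiv ℝ (fun x => conj (φ x)) r v = conj (fderiv ℝ φ r v) := by
  simp_rw [starRingEnd_apply, fderiv_star]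
  rfl

lemma contDiff_conj {E : Type*} [NormedAddCommGroup E] [NormedSpace ℝ E] {n : WithTop ℕ∞}
    {φ : E → ℂ} (h : ContDiff ℝ n φ) : ContDiff ℝ n fun x => conj (φ x) :=
  Complex.conjCLE.toContinuousLinearMap.contDiff.comp h

lemma hasCompactSupport_conj {E : Type*} [TopologicalSpace E] {φ : E → ℂ}
    (h : HasCompactSupport φ) : HasCompactSupport fun x => conj (φ x) :=
  h.comp_left (g := conj) (map_zero _)

lemma integral_fderiv_apply_eq_zero {E F : Type*} [NormedAddCommGroup E] [NormedSpace ℝ E]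
    [FiniteDimensional ℝ E] [MeasurableSpace E] [BorelSpace E] [NormedAddCommGroup F]
    [NormedSpace ℝ F] {μ : Measure E} [μ.IsAddHaarMeasure] {f : E → F} (hf : ContDiff ℝ 1 f)
    (hc : HasCompactSupport f) (v : E) : ∫ x, fderiv ℝ f x v ∂μ = 0 := by
  have hcont : Continuous fun x => fderiv ℝ f x v :=
    (hf.continuous_fderiv one_ne_zero).clm_apply continuous_const
  have hint : Integrable (fun x => fderiv ℝ f x v) μ :=
    hcont.integrable_of_hasCompactSupport (hc.fderiv_apply (𝕜 := ℝ) v)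
  simpa using integral_smul_fderiv_eq_neg_fderiv_smul_of_integrable (μ := μ)
    (f := fun _ : E => (1 : ℝ)) (g := f) (v := v) (by simp) (by simpa using hint)
    (by simpa using hf.continuous.integrable_of_hasCompactSupport hc)
    (fun x _ => by fun_prop) (fun x _ => hf.differentiable one_ne_zero x)

lemma momentum_continuous {ħ κ : ℝ} {A : Plane → Plane} {j : Fin 2}
    (hA : Continuous fun r => A r j) {φ : Plane → ℂ} (hφ : ContDiff ℝ 1 φ) :
    Continuous (momentum ħ κ A j φ) :=
  (momentum_contDiff (k := 0) (n := 1) (by simp) (contDiff_zero.2 hA) hφ).continuous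

lemma conj_momentum_mul_sub_conj_mul_momentum {ħ κ : ℝ} {A : Plane → Plane} {j : Fin 2}
    {φ ψ : Plane → ℂ} (hφ : Differentiable ℝ φ) (hψ : Differentiable ℝ ψ) (r : Plane) :
    conj (momentum ħ κ A j φ r) * ψ r - conj (φ r) * momentum ħ κ A j ψ r =
      Complex.I * ħ * fderiv ℝ (fun x => conj (φ x) * ψ x) r (e j) := by
  have hφ' : DifferentiableAt ℝ (fun x => conj (φ x)) r := (hφ r).star
  rw [fderiv_fun_mul hφ' (hψ r)]
  simp only [momentum, map_sub, map_mul, map_neg, Complex.conj_I, Complex.conj_ofReal, add_apply,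
    smul_apply, smul_eq_mul, fderiv_conj_apply]
  ring

lemma integral_conj_momentum_mul {ħ κ : ℝ} {A : Plane → Plane} {j : Fin 2}
    (hA : Continuous fun r => A r j) {φ ψ : Plane → ℂ} (hφ : ContDiff ℝ 1 φ) (hψ : ContDiff ℝ 1 ψ)
    (hc : HasCompactSupport φ) :
    ∫ r, conj (momentum ħ κ A j φ r) * ψ r = ∫ r, conj (φ r) * momentum ħ κ A j ψ r := by
  have hleft : Integrable fun r => conj (momentum ħ κ A j φ r) * ψ r :=
    ((Complex.continuous_conj.comp (momentum_continuous hA hφ)).mul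
      hψ.continuous).integrable_of_hasCompactSupport
      (hasCompactSupport_conj (momentum_hasCompactSupport hc)).mul_right
  have hright : Integrable fun r => conj (φ r) * momentum ħ κ A j ψ r :=
    ((Complex.continuous_conj.comp hφ.continuous).mul
      (momentum_continuous hA hψ)).integrable_of_hasCompactSupport
      (hasCompactSupport_conj hc).mul_right
  rw [← sub_eq_zero, ← integral_sub hleft hright]
  simp only [conj_momentum_mul_sub_conj_mul_momentum (hφ.differentiable one_ne_zero)
    (hψ.differentiable one_ne_zero), integral_const_mul]
  rw [integral_fderiv_apply_eq_zero ((contDiff_conj hφ).mul hψ)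
    (hasCompactSupport_conj hc).mul_right, mul_zero]

lemma memLp_test (φ : testFunctions) : MemLp φ.1 2 (volume : Measure Plane) :=
  φ.2.1.continuous.memLp_of_hasCompactSupport φ.2.2

lemma testToL2_apply (φ : testFunctions) : testToL2 φ = (memLp_test φ).toLp φ.1 := rfl

lemma denseRange_testToL2 : DenseRange testToL2 := by
  refine (Lp.dense_hasCompactSupport_contDiff (E := Plane) (F := ℂ) (p := 2) (μ := volume)
    (by simp)).mono ?_
  rintro f ⟨g, hfg, hg, hg'⟩
  refine ⟨⟨g, hg', hg⟩, ?_⟩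
  ext1
  exact (memLp_test ⟨g, hg', hg⟩).coeFn_toLp.trans hfg.symm

section Symmetry

variable {m ħ κ : ℝ} {A : Plane → Plane} {V : Plane → ℝ}

lemma integral_conj_potential_mul (φ ψ : Plane → ℂ) :
    ∫ r, conj ((V r : ℂ) * φ r) * ψ r = ∫ r, conj (φ r) * ((V r : ℂ) * ψ r) := by
  simp only [map_mul, Complex.conj_ofReal]
  congr with r
  ring

variable (hA : ∀ j, ContDiff ℝ 1 (fun r => A r j))
include hA

lemma contDiff_momentum_test (φ : testFunctions) (j : Fin 2) :
    ContDiff ℝ 1 (momentum ħ κ A j φ.1) :=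
  momentum_contDiff (k := 1) (n := ⊤) le_top (by exact_mod_cast hA j) φ.2.1

lemma memLp_momentum_momentum_test (φ : testFunctions) (j : Fin 2) :
    MemLp (momentum ħ κ A j (momentum ħ κ A j φ.1)) 2 (volume : Measure Plane) :=
  (momentum_continuous (hA j).continuous
    (contDiff_momentum_test hA φ j)).memLp_of_hasCompactSupport
    (momentum_hasCompactSupport (momentum_hasCompactSupport φ.2.2))

lemma integral_conj_momentum_momentum_mul (φ ψ : testFunctions) (j : Fin 2) :
    ∫ r, conj (momentum ħ κ A j (momentum ħ κ A j φ.1) r) * ψ.1 r =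
      ∫ r, conj (φ.1 r) * momentum ħ κ A j (momentum ħ κ A j ψ.1) r := by
  rw [integral_conj_momentum_mul (hA j).continuous (contDiff_momentum_test hA φ j)
      (ψ.2.1.of_le (by simp)) (momentum_hasCompactSupport φ.2.2),
    integral_conj_momentum_mul (hA j).continuous (φ.2.1.of_le (by simp))
      (contDiff_momentum_test hA ψ j) φ.2.2]

variable (hV : IsLocallyL2 V)

lemma hamiltonianOnTest_apply (φ : testFunctions) :
    hamiltonianOnTest m ħ κ A V hA hV φ =
      (1 / (2 * (m : ℂ))) • ∑ j, (memLp_momentum_momentum_test (ħ := ħ) (κ := κ) hA φ j).toLp _ +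
        (memLp_potential_mul hV φ.2.1.continuous φ.2.2).toLp _ := by
  simp only [Fin.sum_univ_two, ← MemLp.toLp_add, ← MemLp.toLp_const_smul]
  exact MemLp.toLp_congr (memLp_hamiltonianExpr hA hV φ.2) _ (.of_forall fun r => by
    simp [hamiltonianExpr, Fin.sum_univ_two, mul_add])

lemma hamiltonianOnTest_symmetric (φ ψ : testFunctions) :
    inner ℂ (hamiltonianOnTest m ħ κ A V hA hV φ) (testToL2 ψ) =
      inner ℂ (testToL2 φ) (hamiltonianOnTest m ħ κ A V hA hV ψ) := by
  have hm : conj (1 / (2 * (m : ℂ))) = 1 / (2 * (m : ℂ)) := by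
    simp [Complex.conj_ofReal, Complex.conj_ofNat]
  simp only [hamiltonianOnTest_apply, testToL2_apply, inner_add_left, inner_add_right,
    inner_smul_left, inner_smul_right, sum_inner, inner_sum, inner_toLp,
    integral_conj_potential_mul, integral_conj_momentum_momentum_mul hA, hm]

lemma schrodinger_graph :
    (schrodinger m ħ κ A V hA hV).graph =
      LinearMap.range (testToL2.prod (hamiltonianOnTest m ħ κ A V hA hV)) := by
  ext p
  rw [LinearPMap.mem_graph_iff]
  constructor
  · rintro ⟨⟨x, φ, rfl⟩, hx, hTx⟩
    exact ⟨φ, Prod.ext hx ((schrodinger_apply m ħ κ A V hA hV φ).symm.trans hTx)⟩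
  · rintro ⟨φ, rfl⟩
    exact ⟨⟨testToL2 φ, φ, rfl⟩, rfl, schrodinger_apply m ħ κ A V hA hV φ⟩

end Symmetry

/-! ### Covariant momenta in a uniform magnetic field -/

lemma contDiff_uniformPotential {n : WithTop ℕ∞} (β : ℝ) (j : Fin 2) :
    ContDiff ℝ n (fun r => uniformPotential β r j) := by
  fin_cases j
  · exact contDiff_const.mul (by fun_prop)
  · exact contDiff_const.mul (by fun_prop)

/-- The covariant momentum `-i ∂_j - (A_β)_j` as an endomorphism of `C^∞_c`. -/
noncomputable def covMomentum (β : ℝ) (j : Fin 2) : testFunctions →ₗ[ℂ] testFunctions where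
  toFun φ := ⟨momentum 1 1 (uniformPotential β) j φ.1,
    momentum_contDiff (k := ⊤) (n := ⊤) le_top (contDiff_uniformPotential β j) φ.2.1,
    momentum_hasCompactSupport φ.2.2⟩
  map_add' φ ψ := Subtype.ext (momentum_add (φ.2.1.differentiable (by simp))
    (ψ.2.1.differentiable (by simp)))
  map_smul' c φ := Subtype.ext (momentum_smul c (φ.2.1.differentiable (by simp)))

/-- The covariant Laplacian `∑_j (-i ∂_j - (A_β)_j)²` as an endomorphism of `C^∞_c`; it is a
nonnegative operator. -/
noncomputable def covLaplacian (β : ℝ) : testFunctions →ₗ[ℂ] testFunctions :=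
  ∑ j, covMomentum β j ∘ₗ covMomentum β j

section Covariant

variable {β : ℝ}

lemma covMomentum_apply (j : Fin 2) (φ : testFunctions) (r : Plane) :
    (covMomentum β j φ).1 r =
      -Complex.I * fderiv ℝ φ.1 r (e j) - (uniformPotential β r j : ℂ) * φ.1 r := by
  simp [covMomentum, momentum]

lemma covMomentum_symmetric (j : Fin 2) (φ ψ : testFunctions) :
    inner ℂ (testToL2 (covMomentum β j φ)) (testToL2 ψ) =
      inner ℂ (testToL2 φ) (testToL2 (covMomentum β j ψ)) := by
  simp only [testToL2_apply, inner_toLp]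
  exact integral_conj_momentum_mul (contDiff_uniformPotential (n := 1) β j).continuous
    (φ.2.1.of_le (by simp)) (ψ.2.1.of_le (by simp)) φ.2.2

lemma covLaplacian_apply (φ : testFunctions) :
    covLaplacian β φ =
      covMomentum β 0 (covMomentum β 0 φ) + covMomentum β 1 (covMomentum β 1 φ) := by
  simp [covLaplacian, Fin.sum_univ_two]

lemma covLaplacian_symmetric (φ ψ : testFunctions) :
    inner ℂ (testToL2 (covLaplacian β φ)) (testToL2 ψ) =
      inner ℂ (testToL2 φ) (testToL2 (covLaplacian β ψ)) := by
  simp only [covLaplacian_apply, map_add, inner_add_left, inner_add_right, covMomentum_symmetric]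

lemma fderiv_covMomentum_apply (j : Fin 2) (φ : testFunctions) (r v : Plane) :
    fderiv ℝ (covMomentum β j φ).1 r v =
      -Complex.I * fderiv ℝ (fderiv ℝ φ.1) r v (e j) -
        ((uniformPotential β r j : ℂ) * fderiv ℝ φ.1 r v +
          (uniformPotential β v j : ℂ) * φ.1 r) := by
  have hφ : HasFDerivAt φ.1 (fderiv ℝ φ.1 r) r :=
    (φ.2.1.differentiable (by simp) r).hasFDerivAt
  have hφ' : HasFDerivAt (fderiv ℝ φ.1) (fderiv ℝ (fderiv ℝ φ.1) r) r :=
    ((φ.2.1.fderiv_right (m := 1) (by norm_cast)).differentiable one_ne_zero r).hasFDerivAt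
  have hA : HasFDerivAt (fun x => (uniformPotential β x j : ℂ))
      (Complex.ofRealCLM ∘L (if j = 0 then -(β / 2) • (EuclideanSpace.proj 1 : Plane →L[ℝ] ℝ)
        else (β / 2) • (EuclideanSpace.proj 0 : Plane →L[ℝ] ℝ))) r := by
    refine Complex.ofRealCLM.hasFDerivAt.comp r ?_
    fin_cases j
    · exact ((EuclideanSpace.proj 1 : Plane →L[ℝ] ℝ).hasFDerivAt).const_mul (-(β / 2))
    · exact ((EuclideanSpace.proj 0 : Plane →L[ℝ] ℝ).hasFDerivAt).const_mul (β / 2)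
  have hP := ((hφ'.clm_apply (hasFDerivAt_const (e j) r)).const_mul (-Complex.I)).sub (hA.mul hφ)
  rw [(hP.congr_of_eventuallyEq (.of_forall (covMomentum_apply j φ))).fderiv]
  fin_cases j <;> simp [uniformPotential] <;> ring

lemma covMomentum_comm (φ : testFunctions) :
    covMomentum β 0 (covMomentum β 1 φ) - covMomentum β 1 (covMomentum β 0 φ) =
      (Complex.I * β) • φ := by
  refine Subtype.ext (funext fun r => ?_)
  have hsymm : fderiv ℝ (fderiv ℝ φ.1) r (e 0) (e 1) = fderiv ℝ (fderiv ℝ φ.1) r (e 1) (e 0) :=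
    (φ.2.1.contDiffAt (x := r)).isSymmSndFDerivAt
      (by
      rw [minSmoothness_of_isRCLikeNormedField]
      exact WithTop.coe_le_coe.2 le_top) _ _
  change (covMomentum β 0 (covMomentum β 1 φ)).1 r - (covMomentum β 1 (covMomentum β 0 φ)).1 r =
    (Complex.I * β) * φ.1 r
  simp only [covMomentum_apply, fderiv_covMomentum_apply]
  rw [hsymm]
  simp [uniformPotential]
  ring

lemma re_inner_covLaplacian_self_nonneg (φ : testFunctions) :
    0 ≤ RCLike.re (inner ℂ ((testToL2 ∘ₗ covLaplacian β) φ) (testToL2 φ)) := by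
  rw [LinearMap.comp_apply, covLaplacian_apply,
    inner_sq_add_sq_self (covMomentum_symmetric 0) (covMomentum_symmetric 1)]
  rw [RCLike.re_eq_complex_re, Complex.ofReal_re]
  positivity

lemma sum_norm_sq_covMomentum_le (φ : testFunctions) :
    ‖testToL2 (covMomentum β 0 φ)‖ ^ 2 + ‖testToL2 (covMomentum β 1 φ)‖ ^ 2 ≤
      ‖testToL2 φ‖ * ‖testToL2 (covLaplacian β φ)‖ := by
  rw [covLaplacian_apply]
  exact norm_sq_add_norm_sq_le (covMomentum_symmetric 0) (covMomentum_symmetric 1) φ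

lemma norm_covMomentum_covMomentum_le (j k : Fin 2) (φ : testFunctions) :
    ‖testToL2 (covMomentum β j (covMomentum β k φ))‖ ≤
      ‖testToL2 (covLaplacian β φ)‖ + |β| * ‖testToL2 φ‖ := by
  have h₀₁ := norm_sq_second_order_le (covMomentum_symmetric 0) (covMomentum_symmetric 1)
    (covMomentum_comm (β := β)) φ
  have h₁₀ := norm_sq_second_order_le (covMomentum_symmetric (β := β) 1) (covMomentum_symmetric 0)
    (β := -β) (fun χ => by
      rw [← neg_sub, covMomentum_comm, Complex.ofReal_neg, mul_neg, neg_smul]) φ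
  rw [← covLaplacian_apply] at h₀₁
  rw [add_comm (covMomentum β 1 _), ← covLaplacian_apply, abs_neg] at h₁₀
  refine abs_le_of_sq_le_sq' ?_ (by positivity) |>.2
  fin_cases j <;> fin_cases k <;> dsimp only [Fin.zero_eta, Fin.mk_one] <;>
    nlinarith [sq_nonneg ‖testToL2 (covMomentum β 0 (covMomentum β 0 φ))‖,
      sq_nonneg ‖testToL2 (covMomentum β 1 (covMomentum β 1 φ))‖,
      sq_nonneg ‖testToL2 (covMomentum β 0 (covMomentum β 1 φ))‖,
      sq_nonneg ‖testToL2 (covMomentum β 1 (covMomentum β 0 φ))‖]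

end Covariant

/-! ### A maximum principle -/

lemma nonpos_of_isLocalMax_of_hasDerivAt {f f' : ℝ → ℝ} {a c : ℝ}
    (hf : ∀ t, HasDerivAt f (f' t) t) (hf' : HasDerivAt f' c a) (hmax : IsLocalMax f a) :
    c ≤ 0 := by
  by_contra! hc
  have hd : deriv f = f' := funext fun t => (hf t).deriv
  have hmin : IsLocalMin f a :=
    isLocalMin_of_deriv_deriv_pos (by rwa [hd, hf'.deriv]) hmax.deriv_eq_zero (hf a).continuousAt
  have hconst : f =ᶠ[𝓝 a] fun _ => f a := by
    filter_upwards [hmin, hmax] with t ht ht' using le_antisymm ht' ht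
  have hzero : f' =ᶠ[𝓝 a] fun _ => 0 := by
    filter_upwards [hconst.eventuallyEq_nhds] with t ht
    rw [← (hf t).deriv, ht.deriv_eq, deriv_const]
  exact hc.ne' (hf'.unique (hzero.hasDerivAt_iff.2 (hasDerivAt_const a 0)))

lemma hasDerivAt_comp_line {E F : Type*} [AddCommGroup E] [Module ℝ E] [NormedAddCommGroup F]
    [NormedSpace ℝ F] {f f' : E → F} {v : E} (h : ∀ y, HasLineDerivAt ℝ f (f' y) y v) (x : E)
    (t : ℝ) : HasDerivAt (fun s : ℝ => f (x + s • v)) (f' (x + t • v)) t := by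
  have hline : HasDerivAt (fun s : ℝ => f (x + t • v + s • v)) (f' (x + t • v)) (t - t) := by
    rw [sub_self]
    exact h (x + t • v)
  simpa [sub_smul, add_assoc] using hline.comp_sub_const t t

section MaximumPrinciple

variable {E ι : Type*} [NormedAddCommGroup E] [InnerProductSpace ℝ E]

lemma le_of_isMaxOn_sub_mul_norm_sq {w w₁ w₂ : E → ℝ} {v x : E} {δ : ℝ}
    (h₁ : ∀ y, HasLineDerivAt ℝ w (w₁ y) y v) (h₂ : ∀ y, HasLineDerivAt ℝ w₁ (w₂ y) y v)
    (hx : ∀ y, w y - δ * ‖y‖ ^ 2 ≤ w x - δ * ‖x‖ ^ 2) : w₂ x ≤ 2 * δ * ‖v‖ ^ 2 := by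
  have hline (t : ℝ) : HasDerivAt (fun s : ℝ => x + s • v) v t := by
    simpa using ((hasDerivAt_id t).smul_const v).const_add x
  have hd₁ (t : ℝ) := (hasDerivAt_comp_line h₁ x t).sub ((hline t).norm_sq.const_mul δ)
  have hd₂ := (hasDerivAt_comp_line h₂ x 0).sub
    ((((hline 0).inner ℝ (hasDerivAt_const 0 v)).const_mul 2).const_mul δ)
  have hmax : IsLocalMax (fun s : ℝ => w (x + s • v) - δ * ‖x + s • v‖ ^ 2) 0 :=
    .of_forall fun s => by simpa using hx (x + s • v)
  have := nonpos_of_isLocalMax_of_hasDerivAt hd₁ hd₂ hmax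
  simp only [zero_smul, add_zero, inner_zero_right, zero_add, real_inner_self_eq_norm_sq] at this
  linarith

/-- Penalizing by `δ ‖y‖²` makes the supremum of `w` attained; then let `δ → 0`. -/
lemma nonpos_of_mul_le_sum_hasLineDerivAt [ProperSpace E] [Fintype ι] {w : E → ℝ}
    {w₁ w₂ : ι → E → ℝ} {v : ι → E} {l C : ℝ} (hl : 0 < l) (hw : Continuous w)
    (hC : ∀ x, w x ≤ C) (h₁ : ∀ j x, HasLineDerivAt ℝ w (w₁ j x) x (v j))
    (h₂ : ∀ j x, HasLineDerivAt ℝ (w₁ j) (w₂ j x) x (v j))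
    (hlap : ∀ x, l * w x ≤ ∑ j, w₂ j x) (x : E) : w x ≤ 0 := by
  set S : ℝ := ∑ j, 2 * ‖v j‖ ^ 2
  have hbound (δ : ℝ) (hδ : 0 < δ) : w x ≤ δ * (S / l + ‖x‖ ^ 2) := by
    have hlim : Tendsto (fun y : E => w y - δ * ‖y‖ ^ 2) (cocompact E) atBot := by
      refine tendsto_atBot_mono (fun y => sub_le_sub_right (hC y) (δ * ‖y‖ ^ 2)) ?_
      simp only [sub_eq_add_neg]
      exact tendsto_atBot_add_const_left _ C (tendsto_neg_atTop_atBot.comp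
        (((tendsto_pow_atTop two_ne_zero).comp tendsto_norm_cocompact_atTop).const_mul_atTop hδ))
    obtain ⟨x₀, hx₀⟩ := (show Continuous fun y => w y - δ * ‖y‖ ^ 2 by
      fun_prop).exists_forall_ge hlim
    have hsum : l * w x₀ ≤ δ * S := by
      refine (hlap x₀).trans ?_
      rw [Finset.mul_sum]
      exact Finset.sum_le_sum fun j _ =>
        (le_of_isMaxOn_sub_mul_norm_sq (h₁ j) (h₂ j) hx₀).trans_eq (by ring)
    have hx₀' : w x₀ ≤ δ * (S / l) := by
      rw [← mul_div_assoc, le_div_iff₀' hl]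
      exact hsum
    have : 0 ≤ δ * ‖x₀‖ ^ 2 := by positivity
    linarith [hx₀ x]
  have hlim : Tendsto (fun δ : ℝ => δ * (S / l + ‖x‖ ^ 2)) (𝓝[>] 0) (𝓝 0) := by
    refine Tendsto.mono_left ?_ nhdsWithin_le_nhds
    exact (continuous_mul_const (S / l + ‖x‖ ^ 2)).tendsto' 0 0 (zero_mul _)
  exact ge_of_tendsto hlim (eventually_nhdsWithin_of_forall hbound)

end MaximumPrinciple

/-! ### Covariant derivatives along lines -/

section CovariantLineDeriv

variable {E : Type*} [AddCommGroup E] [Module ℝ E] {f g : E → ℂ} {f₁ g₁ : ℂ} {α : ℝ} {x v : E}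

lemma hasLineDerivAt_conj_mul
    (hf : HasLineDerivAt ℝ f (Complex.I * f₁ + Complex.I * α * f x) x v)
    (hg : HasLineDerivAt ℝ g (Complex.I * g₁ + Complex.I * α * g x) x v) :
    HasLineDerivAt ℝ (fun y => conj (f y) * g y)
      (Complex.I * (conj (f x) * g₁ - conj f₁ * g x)) x v := by
  have hf' : HasDerivAt (fun s : ℝ => conj (f (x + s • v)))
      (conj (Complex.I * f₁ + Complex.I * α * f x)) 0 :=
    Complex.conjCLE.toContinuousLinearMap.hasFDerivAt.comp_hasDerivAt 0 hf
  refine (hf'.mul hg).congr_deriv ?_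
  simp only [zero_smul, add_zero, map_add, map_mul, Complex.conj_I, Complex.conj_ofReal]
  ring

lemma hasLineDerivAt_norm_sq
    (hf : HasLineDerivAt ℝ f (Complex.I * f₁ + Complex.I * α * f x) x v) :
    HasLineDerivAt ℝ (fun y => ‖f y‖ ^ 2) (-2 * (conj (f x) * f₁).im) x v := by
  have h := Complex.reCLM.hasFDerivAt.comp_hasDerivAt 0 (hasLineDerivAt_conj_mul hf hf)
  have hsq : (fun s : ℝ => ‖f (x + s • v)‖ ^ 2) =
      Complex.reCLM ∘ fun s : ℝ => conj (f (x + s • v)) * f (x + s • v) := by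
    funext s
    rw [Function.comp_apply, Complex.conj_mul', ← Complex.ofReal_pow]
    exact (Complex.ofReal_re _).symm
  rw [HasLineDerivAt, hsq]
  refine h.congr_deriv ?_
  simp
  ring

lemma hasLineDerivAt_im_conj_mul {f₁ : E → ℂ} {f₂ : ℂ}
    (hf : HasLineDerivAt ℝ f (Complex.I * f₁ x + Complex.I * α * f x) x v)
    (hf₁ : HasLineDerivAt ℝ f₁ (Complex.I * f₂ + Complex.I * α * f₁ x) x v) :
    HasLineDerivAt ℝ (fun y => -2 * (conj (f y) * f₁ y).im)
      (2 * ‖f₁ x‖ ^ 2 - 2 * (conj (f x) * f₂).re) x v := by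
  have h := (Complex.imCLM.hasFDerivAt.comp_hasDerivAt 0
    (hasLineDerivAt_conj_mul hf hf₁)).const_mul (-2)
  refine h.congr_deriv ?_
  rw [Complex.imCLM_apply, Complex.I_mul_im, Complex.conj_mul', ← Complex.ofReal_pow,
    Complex.sub_re, Complex.ofReal_re]
  ring

end CovariantLineDeriv

lemma two_mul_re_conj_mul_add_le (z z₁ z₂ : ℂ) (α : ℝ) :
    -(2 * (conj z * (z₂ + 4 * α * z₁ + 4 * (α : ℂ) ^ 2 * z)).re) ≤
      2 * ‖z₁‖ ^ 2 - 2 * (conj z * z₂).re := by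
  have h : 2 * ‖z₁‖ ^ 2 - 2 * (conj z * z₂).re +
      2 * (conj z * (z₂ + 4 * α * z₁ + 4 * (α : ℂ) ^ 2 * z)).re = 2 * ‖z₁ + 2 * α * z‖ ^ 2 := by
    simp only [← Complex.normSq_eq_norm_sq, Complex.normSq_apply]
    simp only [pow_two, Complex.add_re, Complex.add_im, Complex.mul_re, Complex.mul_im,
      Complex.conj_re, Complex.conj_im, Complex.ofReal_re, Complex.ofReal_im, Complex.re_ofNat,
      Complex.im_ofNat]
    ring
  nlinarith [sq_nonneg ‖z₁ + 2 * α * z‖]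

lemma hasDerivAt_cexp_I_mul (a b t : ℝ) :
    HasDerivAt (fun s : ℝ => Complex.exp (Complex.I * ((a + s * b : ℝ) : ℂ)))
      (Complex.I * b * Complex.exp (Complex.I * ((a + t * b : ℝ) : ℂ))) t := by
  have h : HasDerivAt (fun s : ℝ => a + s * b) b t := by
    simpa using ((hasDerivAt_id t).mul_const b).const_add a
  exact (h.ofReal_comp.const_mul Complex.I).cexp.congr_deriv (mul_comm _ _)

/-! ### Magnetic translations -/

/-- The phase `-A_β(x) · y` of the magnetic translations in the symmetric gauge. -/
noncomputable def magneticPhase (β : ℝ) (x y : Plane) : ℝ :=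
  -(uniformPotential β x 0 * y 0 + uniformPotential β x 1 * y 1)

lemma contDiff_magneticPhase (β : ℝ) (x : Plane) : ContDiff ℝ ∞ (magneticPhase β x) := by
  unfold magneticPhase
  fun_prop

/-- The reflected and magnetically translated function `y ↦ φ (x - y) exp (-i A_β(x) · y)`, which
is the integrand of a twisted convolution. -/
noncomputable def magneticTranslate (β : ℝ) (x : Plane) : testFunctions →ₗ[ℂ] testFunctions where
  toFun φ := ⟨fun y => φ.1 (x - y) * Complex.exp (Complex.I * magneticPhase β x y),
    (φ.2.1.comp (contDiff_const.sub contDiff_id)).mul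
      (Complex.contDiff_exp.comp (contDiff_const.mul
        (Complex.ofRealCLM.contDiff.comp (contDiff_magneticPhase β x)))),
    (φ.2.2.comp_homeomorph (Homeomorph.subLeft x)).mul_right⟩
  map_add' _ _ := Subtype.ext (funext fun _ => add_mul _ _ _)
  map_smul' _ _ := Subtype.ext (funext fun _ => mul_assoc _ _ _)

section MagneticTranslation

variable {β : ℝ}

lemma magneticPhase_zero_left (y : Plane) : magneticPhase β 0 y = 0 := by
  simp [magneticPhase, uniformPotential]

lemma magneticPhase_add_left (x y : Plane) (j : Fin 2) (t : ℝ) :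
    magneticPhase β (x + t • e j) y = magneticPhase β x y + t * uniformPotential β y j := by
  fin_cases j <;> simp [magneticPhase, uniformPotential] <;> ring

lemma magneticPhase_add_right (x y : Plane) (j : Fin 2) (t : ℝ) :
    magneticPhase β x (y + t • e j) = magneticPhase β x y + t * -uniformPotential β x j := by
  fin_cases j <;> simp [magneticPhase, uniformPotential] <;> ring

lemma uniformPotential_sub (x y : Plane) (j : Fin 2) :
    uniformPotential β (x - y) j = uniformPotential β x j - uniformPotential β y j := by
  fin_cases j <;> simp [uniformPotential] <;> ring

lemma magneticTranslate_apply (x y : Plane) (φ : testFunctions) :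
    (magneticTranslate β x φ).1 y = φ.1 (x - y) * Complex.exp (Complex.I * magneticPhase β x y) :=
  rfl

lemma norm_magneticTranslate_apply (x y : Plane) (φ : testFunctions) :
    ‖(magneticTranslate β x φ).1 y‖ = ‖φ.1 (x - y)‖ := by
  rw [magneticTranslate_apply, norm_mul, mul_comm Complex.I, Complex.norm_exp_ofReal_mul_I, mul_one]

lemma hasLineDerivAt_test (j : Fin 2) (φ : testFunctions) (x : Plane) :
    HasLineDerivAt ℝ φ.1 (Complex.I * (covMomentum β j φ).1 x +
      Complex.I * uniformPotential β x j * φ.1 x) x (e j) := by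
  convert! (φ.2.1.differentiable (by simp) x).hasFDerivAt.hasLineDerivAt (e j) using 1
  rw [covMomentum_apply]
  linear_combination (-fderiv ℝ φ.1 x (e j)) * Complex.I_sq

lemma covMomentum_magneticTranslate (x : Plane) (j : Fin 2) (φ : testFunctions) :
    covMomentum β j (magneticTranslate β x φ) = -magneticTranslate β x (covMomentum β j φ) -
      (2 * (uniformPotential β x j : ℂ)) • magneticTranslate β x φ := by
  refine Subtype.ext (funext fun y => ?_)
  have hφ : HasDerivAt (fun s : ℝ => φ.1 (x - (y + s • e j)))
      (-(Complex.I * (covMomentum β j φ).1 (x - y) +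
        Complex.I * uniformPotential β (x - y) j * φ.1 (x - y))) 0 := by
    have h := (hasDerivAt_comp_line (hasLineDerivAt_test (β := β) j φ) (x - y) (-0)).scomp 0
      (hasDerivAt_neg (0 : ℝ))
    simpa only [Function.comp_def, neg_smul, ← sub_eq_add_neg, sub_sub, neg_zero, zero_smul,
      sub_zero, add_zero, one_smul] using h
  have hexp := hasDerivAt_cexp_I_mul (magneticPhase β x y) (-uniformPotential β x j) 0
  simp only [← magneticPhase_add_right] at hexp
  have h := (hasLineDerivAt_test (β := β) j (magneticTranslate β x φ) y).unique (hφ.mul hexp)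
  simp only [zero_smul, add_zero, magneticTranslate_apply, uniformPotential_sub,
    Complex.ofReal_sub, Complex.ofReal_neg] at h
  refine mul_left_cancel₀ Complex.I_ne_zero ?_
  change Complex.I * (covMomentum β j (magneticTranslate β x φ)).1 y =
    Complex.I * (-((covMomentum β j φ).1 (x - y) * Complex.exp (Complex.I * magneticPhase β x y)) -
      2 * (uniformPotential β x j : ℂ) *
        (φ.1 (x - y) * Complex.exp (Complex.I * magneticPhase β x y)))
  linear_combination h

lemma covMomentum_sq_magneticTranslate (x : Plane) (j : Fin 2) (φ : testFunctions) :
    covMomentum β j (covMomentum β j (magneticTranslate β x φ)) =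
      magneticTranslate β x (covMomentum β j (covMomentum β j φ)) +
      (4 * (uniformPotential β x j : ℂ)) • magneticTranslate β x (covMomentum β j φ) +
      (4 * (uniformPotential β x j : ℂ) ^ 2) • magneticTranslate β x φ := by
  rw [covMomentum_magneticTranslate, map_sub, map_neg, map_smul, covMomentum_magneticTranslate,
    covMomentum_magneticTranslate]
  module

lemma hasLineDerivAt_magneticTranslate (x y : Plane) (j : Fin 2) (φ : testFunctions) :
    HasLineDerivAt ℝ (fun x => (magneticTranslate β x φ).1 y)
      (Complex.I * (magneticTranslate β x (covMomentum β j φ)).1 y +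
        Complex.I * uniformPotential β x j * (magneticTranslate β x φ).1 y) x (e j) := by
  have hφ : HasDerivAt (fun s : ℝ => φ.1 (x + s • e j - y))
      (Complex.I * (covMomentum β j φ).1 (x - y) +
        Complex.I * uniformPotential β (x - y) j * φ.1 (x - y)) 0 := by
    simpa only [HasLineDerivAt, sub_add_eq_add_sub] using
      hasLineDerivAt_test (β := β) j φ (x - y)
  have hexp := hasDerivAt_cexp_I_mul (magneticPhase β x y) (uniformPotential β y j) 0
  simp only [← magneticPhase_add_left] at hexp
  refine (hφ.mul hexp).congr_deriv ?_
  simp only [zero_smul, add_zero, magneticTranslate_apply, uniformPotential_sub,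
    Complex.ofReal_sub]
  ring

/-! ### Density of the range of the covariant Laplacian plus a positive constant -/

/-- The twisted convolution `x ↦ ⟨u, τ_x φ⟩` of `u` and `φ`. -/
noncomputable def twistedConv (β : ℝ) (u : L2) (φ : testFunctions) (x : Plane) : ℂ :=
  inner ℂ u (testToL2 (magneticTranslate β x φ))

lemma inner_testToL2_right (u : L2) (φ : testFunctions) :
    inner ℂ u (testToL2 φ) = ∫ y, conj (u y) * φ.1 y := by
  rw [testToL2_apply, ← inner_toLp (Lp.memLp u) (memLp_test φ), Lp.toLp_coeFn]

lemma twistedConv_eq_integral (u : L2) (φ : testFunctions) :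
    twistedConv β u φ = fun x => ∫ y, conj (u y) * (magneticTranslate β x φ).1 y :=
  funext fun _ => inner_testToL2_right _ _

lemma norm_twistedConv_le (u : L2) (φ : testFunctions) (x : Plane) :
    ‖twistedConv β u φ x‖ ≤ ‖u‖ * ‖testToL2 φ‖ := by
  have hnorm : ‖testToL2 (magneticTranslate β x φ)‖ = ‖testToL2 φ‖ := by
    rw [testToL2_apply, testToL2_apply, Lp.norm_toLp, Lp.norm_toLp,
      eLpNorm_congr_norm_ae (g := fun y => φ.1 (x - y))
        (.of_forall fun y => norm_magneticTranslate_apply x y φ)]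
    exact congrArg ENNReal.toReal (eLpNorm_comp_measurePreserving (memLp_test φ).1
      (Measure.measurePreserving_sub_left volume x))
  exact (norm_inner_le_norm _ _).trans_eq (by rw [hnorm])

lemma aestronglyMeasurable_conj_mul_test (u : L2) (φ : testFunctions) :
    AEStronglyMeasurable (fun y => conj (u y) * φ.1 y) (volume : Measure Plane) :=
  (Complex.continuous_conj.comp_aestronglyMeasurable (Lp.memLp u).1).mul
    φ.2.1.continuous.aestronglyMeasurable

lemma exists_integrable_bound_magneticTranslate (u : L2) (φ : testFunctions) (x : Plane) :
    ∃ g : Plane → ℝ, Integrable g (volume : Measure Plane) ∧ ∀ z ∈ Metric.ball x 1, ∀ y,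
      ‖conj (u y) * (magneticTranslate β z φ).1 y‖ ≤ g y := by
  obtain ⟨C, hC⟩ := φ.2.1.continuous.bounded_above_of_compact_support φ.2.2
  obtain ⟨R, hR⟩ := φ.2.2.isCompact.isBounded.exists_norm_le
  set B := Metric.closedBall x (R + 1)
  have hint : IntegrableOn u B :=
    ((Lp.memLp u).locallyIntegrable (by norm_num)).integrableOn_isCompact
      (isCompact_closedBall _ _)
  refine ⟨B.indicator fun y => C * ‖u y‖,
    (integrable_indicator_iff measurableSet_closedBall).2 (hint.norm.const_mul C),
    fun z hz y => ?_⟩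
  rw [norm_mul, RCLike.norm_conj, norm_magneticTranslate_apply]
  by_cases hy : y ∈ B
  · rw [Set.indicator_of_mem hy, mul_comm]
    gcongr
    exact hC _
  · have hzero : φ.1 (z - y) = 0 := by
      by_contra h
      refine hy (Metric.mem_closedBall.2 ?_)
      calc dist y x ≤ dist y z + dist z x := dist_triangle _ _ _
        _ ≤ R + 1 := by
          gcongr
          · rw [dist_comm, dist_eq_norm]
            exact hR _ (subset_tsupport _ h)
          · exact (Metric.mem_ball.1 hz).le
    simp [Set.indicator_of_notMem hy, hzero]

lemma integrable_conj_mul_test (u : L2) (φ : testFunctions) :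
    Integrable (fun y => conj (u y) * φ.1 y) (volume : Measure Plane) :=
  (Lp.memLp u).star.integrable_mul (memLp_test φ)

lemma hasLineDerivAt_twistedConv (u : L2) (φ : testFunctions) (j : Fin 2) (x : Plane) :
    HasLineDerivAt ℝ (twistedConv β u φ) (Complex.I * twistedConv β u (covMomentum β j φ) x +
      Complex.I * uniformPotential β x j * twistedConv β u φ x) x (e j) := by
  obtain ⟨g₁, hg₁, hb₁⟩ := exists_integrable_bound_magneticTranslate (β := β) u φ x
  obtain ⟨g₂, hg₂, hb₂⟩ :=
    exists_integrable_bound_magneticTranslate (β := β) u (covMomentum β j φ) x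
  have hball (s : ℝ) (hs : s ∈ Metric.ball 0 1) : x + s • e j ∈ Metric.ball x 1 := by
    simpa [norm_smul] using hs
  have hconst (s : ℝ) : uniformPotential β (x + s • e j) j = uniformPotential β x j := by
    fin_cases j <;> simp [uniformPotential]
  let F' (s : ℝ) (y : Plane) : ℂ :=
    Complex.I * (conj (u y) * (magneticTranslate β (x + s • e j) (covMomentum β j φ)).1 y) +
      Complex.I * uniformPotential β x j *
        (conj (u y) * (magneticTranslate β (x + s • e j) φ).1 y)
  have hF' (y : Plane) (s : ℝ) :
      HasDerivAt (fun s : ℝ => conj (u y) * (magneticTranslate β (x + s • e j) φ).1 y)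
        (F' s y) s := by
    refine ((hasDerivAt_comp_line (hasLineDerivAt_magneticTranslate (β := β) · y j φ)
      x s).const_mul (conj (u y))).congr_deriv ?_
    rw [hconst]
    ring
  have hbound (y : Plane) (s : ℝ) (hs : s ∈ Metric.ball 0 1) :
      ‖F' s y‖ ≤ g₂ y + ‖Complex.I * (uniformPotential β x j : ℂ)‖ * g₁ y := by
    refine (norm_add_le _ _).trans (add_le_add ?_ ?_)
    · rw [norm_mul, Complex.norm_I, one_mul]
      exact hb₂ _ (hball s hs) y
    · rw [norm_mul]
      gcongr
      exact hb₁ _ (hball s hs) y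
  have hi₁ := (integrable_conj_mul_test u
    (magneticTranslate β (x + (0 : ℝ) • e j) (covMomentum β j φ))).const_mul Complex.I
  have hi₂ := (integrable_conj_mul_test u
    (magneticTranslate β (x + (0 : ℝ) • e j) φ)).const_mul
      (Complex.I * (uniformPotential β x j : ℂ))
  have hderiv := (hasDerivAt_integral_of_dominated_loc_of_deriv_le
    (Metric.ball_mem_nhds 0 one_pos)
    (.of_forall fun s => aestronglyMeasurable_conj_mul_test u _)
    (integrable_conj_mul_test u _) (hi₁.add hi₂).1 (.of_forall hbound)
    (hg₂.add (hg₁.const_mul _)) (.of_forall fun y s _ => hF' y s)).2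
  rw [HasLineDerivAt, twistedConv_eq_integral, twistedConv_eq_integral]
  refine hderiv.congr_deriv ?_
  rw [integral_add hi₁ hi₂, integral_const_mul, integral_const_mul, zero_smul, add_zero]

lemma continuous_twistedConv (u : L2) (φ : testFunctions) : Continuous (twistedConv β u φ) := by
  rw [continuous_iff_continuousAt, twistedConv_eq_integral]
  intro x
  obtain ⟨g, hg, hb⟩ := exists_integrable_bound_magneticTranslate (β := β) u φ x
  refine continuousAt_of_dominated (bound := g)
    (.of_forall fun s => aestronglyMeasurable_conj_mul_test _ _) ?_ hg
    (.of_forall fun y => (continuous_const.mul ?_).continuousAt)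
  · filter_upwards [Metric.ball_mem_nhds x one_pos] with z hz using .of_forall (hb z hz)
  · have hphase : Continuous fun z => magneticPhase β z y := by
      simp only [magneticPhase]
      exact (((contDiff_uniformPotential (n := 0) β 0).continuous.mul continuous_const).add
        ((contDiff_uniformPotential (n := 0) β 1).continuous.mul continuous_const)).neg
    have hφ := φ.2.1.continuous
    simp only [magneticTranslate_apply]
    fun_prop

lemma sum_twistedConv_eq {l : ℝ} {u : L2}
    (hu : ∀ φ, inner ℂ u ((testToL2 ∘ₗ covLaplacian β + (l : ℂ) • testToL2) φ) = 0)
    (φ : testFunctions) (x : Plane) :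
    ∑ j, (twistedConv β u (covMomentum β j (covMomentum β j φ)) x +
      4 * (uniformPotential β x j : ℂ) * twistedConv β u (covMomentum β j φ) x +
      4 * (uniformPotential β x j : ℂ) ^ 2 * twistedConv β u φ x) = -l * twistedConv β u φ x := by
  have h := hu (magneticTranslate β x φ)
  simp only [LinearMap.add_apply, LinearMap.comp_apply, LinearMap.smul_apply, covLaplacian_apply,
    covMomentum_sq_magneticTranslate, map_add, map_smul, inner_add_right, inner_smul_right] at h
  simp only [Fin.sum_univ_two, twistedConv]
  linear_combination h

lemma twistedConv_eq_zero {l : ℝ} (hl : 0 < l) {u : L2}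
    (hu : ∀ φ, inner ℂ u ((testToL2 ∘ₗ covLaplacian β + (l : ℂ) • testToL2) φ) = 0)
    (φ : testFunctions) (x : Plane) : twistedConv β u φ x = 0 := by
  set v := twistedConv β u φ with hv
  have hlap (x : Plane) : 2 * l * ‖v x‖ ^ 2 ≤
      ∑ j, (2 * ‖twistedConv β u (covMomentum β j φ) x‖ ^ 2 -
        2 * (conj (v x) * twistedConv β u (covMomentum β j (covMomentum β j φ)) x).re) := by
    refine le_trans (le_of_eq ?_) (Finset.sum_le_sum fun j _ =>
      two_mul_re_conj_mul_add_le (v x) _ _ (uniformPotential β x j))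
    rw [Finset.sum_neg_distrib, ← Finset.mul_sum, ← Complex.re_sum, ← Finset.mul_sum,
      sum_twistedConv_eq hu, ← hv, mul_left_comm, Complex.conj_mul', ← Complex.ofReal_pow,
      ← Complex.ofReal_neg, ← Complex.ofReal_mul, Complex.ofReal_re]
    ring
  have hle := nonpos_of_mul_le_sum_hasLineDerivAt (w := fun x => ‖v x‖ ^ 2)
    (C := (‖u‖ * ‖testToL2 φ‖) ^ 2) (mul_pos two_pos hl)
    ((continuous_twistedConv u φ).norm.pow 2)
    (fun x => pow_le_pow_left₀ (norm_nonneg _) (norm_twistedConv_le u φ x) 2)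
    (fun j x => hasLineDerivAt_norm_sq (hasLineDerivAt_twistedConv u φ j x))
    (fun j x => hasLineDerivAt_im_conj_mul (hasLineDerivAt_twistedConv u φ j x)
      (hasLineDerivAt_twistedConv u (covMomentum β j φ) j x)) hlap x
  exact norm_eq_zero.1 (pow_eq_zero_iff two_ne_zero |>.1 (hle.antisymm (sq_nonneg _)))

theorem denseRange_covLaplacian_add_smul {l : ℝ} (hl : 0 < l) :
    DenseRange (testToL2 ∘ₗ covLaplacian β + (l : ℂ) • testToL2) := by
  refine denseRange_of_forall_inner_eq_zero (𝕜 := ℂ) fun u hu =>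
    denseRange_testToL2.eq_zero_of_inner_left (𝕜 := ℂ) fun φ => ?_
  let ψ : testFunctions := ⟨fun y => φ.1 (-y), φ.2.1.comp contDiff_neg,
    φ.2.2.comp_homeomorph (Homeomorph.neg Plane)⟩
  have hψ : magneticTranslate β 0 ψ = φ :=
    Subtype.ext (funext fun y => by
      rw [magneticTranslate_apply, magneticPhase_zero_left]
      simp [ψ])
  have h := twistedConv_eq_zero hl hu ψ 0
  rwa [twistedConv, hψ] at h

end MagneticTranslation

/-! ### Uniformly locally square integrable potentials -/

/-- The half-open unit square with upper right corner `y`. -/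
def unitBox (y : Plane) : Set Plane := {z | ∀ i, y i - z i ∈ Set.Ioc (0 : ℝ) 1}

/-- `V` is square integrable on unit squares, uniformly in their position; this is the natural
class of potentials in the two-dimensional Sobolev inequality below. -/
def IsUniformlyLocallyL2 (V : Plane → ℝ) : Prop :=
  ∃ N : ℝ≥0, ∀ y, eLpNorm V 2 (volume.restrict (unitBox y)) ≤ N

lemma measurableSet_mem_unitBox : MeasurableSet {p : Plane × Plane | p.1 ∈ unitBox p.2} := by
  have h : {p : Plane × Plane | p.1 ∈ unitBox p.2} =
      ⋂ i, (fun p : Plane × Plane => p.2 i - p.1 i) ⁻¹' Set.Ioc (0 : ℝ) 1 := by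
    ext p
    simp [unitBox]
  rw [h]
  exact MeasurableSet.iInter fun i => (Continuous.measurable (by fun_prop)) measurableSet_Ioc

lemma measurableSet_unitBox (y : Plane) : MeasurableSet (unitBox y) :=
  measurable_prodMk_right measurableSet_mem_unitBox

lemma unitBox_subset_closedBall (y : Plane) : unitBox y ⊆ Metric.closedBall y 2 := by
  intro z hz
  have h : ‖y - z‖ ^ 2 ≤ 2 ^ 2 := by
    rw [EuclideanSpace.norm_sq_eq, Fin.sum_univ_two]
    simp only [PiLp.sub_apply, Real.norm_eq_abs, sq_abs]
    nlinarith [(hz 0).1, (hz 0).2, (hz 1).1, (hz 1).2]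
  rw [Metric.mem_closedBall, dist_comm, dist_eq_norm]
  exact le_of_sq_le_sq h zero_le_two

lemma IsLocallyL2.aestronglyMeasurable {V : Plane → ℝ} (hV : IsLocallyL2 V) :
    AEStronglyMeasurable V (volume : Measure Plane) := by
  have h : AEStronglyMeasurable V
      (volume.restrict (⋃ n : ℕ, Metric.closedBall (0 : Plane) n)) :=
    AEStronglyMeasurable.iUnion fun n => (hV _ (isCompact_closedBall _ _)).1
  rwa [Metric.iUnion_closedBall_nat, Measure.restrict_univ] at h

lemma IsUniformlyLocallyL2.add {V W : Plane → ℝ} (hV : IsUniformlyLocallyL2 V)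
    (hW : IsUniformlyLocallyL2 W) (hVm : AEStronglyMeasurable V (volume : Measure Plane))
    (hWm : AEStronglyMeasurable W (volume : Measure Plane)) :
    IsUniformlyLocallyL2 (fun r => V r + W r) := by
  obtain ⟨N, hN⟩ := hV
  obtain ⟨M, hM⟩ := hW
  refine ⟨N + M, fun y => ?_⟩
  rw [ENNReal.coe_add]
  exact (eLpNorm_add_le hVm.restrict hWm.restrict one_le_two).trans (add_le_add (hN y) (hM y))

lemma isUniformlyLocallyL2_of_bounded {W : Plane → ℝ} {C : ℝ} (hW : ∀ x, ‖W x‖ ≤ C) :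
    IsUniformlyLocallyL2 W := by
  have hfin : volume (Metric.closedBall (0 : Plane) 2) ^ (2 : ℝ≥0∞).toReal⁻¹ *
      ENNReal.ofReal C ≠ ⊤ :=
    ENNReal.mul_ne_top (ENNReal.rpow_ne_top_of_nonneg (by simp)
      (isCompact_closedBall _ _).measure_lt_top.ne) ENNReal.ofReal_ne_top
  refine ⟨_, fun y => le_of_le_of_eq ?_ (ENNReal.coe_toNNReal hfin).symm⟩
  refine (eLpNorm_le_of_ae_bound (.of_forall hW)).trans ?_
  gcongr ?_ ^ _ * _
  rw [Measure.restrict_apply_univ, ← Measure.addHaar_closedBall_center volume y]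
  exact measure_mono (unitBox_subset_closedBall y)

section Periodic

variable {a b : Plane}

lemma norm_le_of_mem_cell {y : Plane} (hy : y ∈ cell a b) : ‖y‖ ≤ ‖a‖ + ‖b‖ := by
  obtain ⟨l₁, h₁, l₂, h₂, rfl⟩ := hy
  have hsmul {l : ℝ} (hl : l ∈ Set.Icc (0 : ℝ) 1) (v : Plane) : ‖l • v‖ ≤ ‖v‖ := by
    rw [norm_smul, Real.norm_of_nonneg hl.1]
    exact mul_le_of_le_one_left (norm_nonneg _) hl.2
  exact (norm_add_le _ _).trans (add_le_add (hsmul h₁ a) (hsmul h₂ b))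

lemma eLpNorm_restrict_unitBox_sub_latticeVec {V : Plane → ℝ} (hp : IsLatticePeriodic a b V)
    (hV : AEStronglyMeasurable V (volume : Measure Plane)) (n : ℤ × ℤ) (y : Plane) :
    eLpNorm V 2 (volume.restrict (unitBox (y - latticeVec a b n))) =
      eLpNorm V 2 (volume.restrict (unitBox y)) := by
  have hpre : (fun r => r - latticeVec a b n) ⁻¹' unitBox (y - latticeVec a b n) = unitBox y := by
    ext z
    simp only [unitBox, Set.mem_preimage, Set.mem_ofPred_eq, PiLp.sub_apply,
      sub_sub_sub_cancel_right]
  have hcomp : V ∘ (fun r => r - latticeVec a b n) = V := by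
    funext r
    have h := hp n (r - latticeVec a b n)
    rw [sub_add_cancel] at h
    exact h.symm
  have hmp := (measurePreserving_sub_right (volume : Measure Plane)
    (latticeVec a b n)).restrict_preimage (measurableSet_unitBox (y - latticeVec a b n))
  rw [hpre] at hmp
  rw [← eLpNorm_comp_measurePreserving hV.restrict hmp, hcomp]

lemma isUniformlyLocallyL2_of_periodic (hab : 0 < wedge a b) {V : Plane → ℝ}
    (hp : IsLatticePeriodic a b V) (hV : IsLocallyL2 V) : IsUniformlyLocallyL2 V := by
  set B := Metric.closedBall (0 : Plane) (‖a‖ + ‖b‖ + 2)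
  have hfin : eLpNorm V 2 (volume.restrict B) ≠ ⊤ := (hV B (isCompact_closedBall _ _)).2.ne
  refine ⟨(eLpNorm V 2 (volume.restrict B)).toNNReal, fun y => ?_⟩
  obtain ⟨n, hn⟩ : ∃ n, y - latticeVec a b n ∈ cell a b := ⟨_, exists_mem_cell hab y⟩
  rw [ENNReal.coe_toNNReal hfin,
    ← eLpNorm_restrict_unitBox_sub_latticeVec hp hV.aestronglyMeasurable n y]
  refine eLpNorm_mono_measure _ (Measure.restrict_mono ?_ le_rfl)
  refine (unitBox_subset_closedBall _).trans (Metric.closedBall_subset_closedBall' ?_)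
  rw [dist_zero_right, add_comm]
  exact add_le_add_left (norm_le_of_mem_cell hn) 2

end Periodic

/-! ### A covariant Sobolev inequality -/

lemma norm_le_integral_norm_add_norm {E : Type*} [NormedAddCommGroup E] [NormedSpace ℝ E]
    [CompleteSpace E] {f f' : ℝ → E} (hf : ∀ t, HasDerivAt f (f' t) t) (hf' : Continuous f') :
    ‖f 0‖ ≤ ∫ t in (0 : ℝ)..1, (‖f t‖ + ‖f' t‖) := by
  have hfc : Continuous f := continuous_iff_continuousAt.2 fun t => (hf t).continuousAt
  have hg (t : ℝ) : HasDerivAt (fun t => (t - 1) • f t) ((t - 1) • f' t + f t) t := by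
    simpa using ((hasDerivAt_id t).sub_const 1).fun_smul (hf t)
  have hint : ∫ t in (0 : ℝ)..1, ((t - 1) • f' t + f t) = f 0 := by
    rw [intervalIntegral.integral_eq_sub_of_hasDerivAt (fun t _ => hg t)
      (Continuous.intervalIntegrable (by fun_prop) _ _)]
    simp
  rw [← hint]
  refine intervalIntegral.norm_integral_le_of_norm_le zero_le_one (.of_forall fun t ht => ?_)
    (Continuous.intervalIntegrable (by fun_prop) _ _)
  have ht' : ‖t - 1‖ ≤ 1 := abs_le.2 ⟨by linarith [ht.1], by linarith [ht.2]⟩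
  calc ‖(t - 1) • f' t + f t‖ ≤ ‖t - 1‖ * ‖f' t‖ + ‖f t‖ :=
        (norm_add_le _ _).trans_eq (by rw [norm_smul])
    _ ≤ ‖f t‖ + ‖f' t‖ := by
        rw [add_comm]
        gcongr
        exact mul_le_of_le_one_left (norm_nonneg _) ht'

lemma ofReal_le_lintegral_of_le_integral {f : ℝ → ℝ} {a : ℝ} (hf : Continuous f)
    (hf₀ : ∀ t, 0 ≤ f t) (h : a ≤ ∫ t in (0 : ℝ)..1, f t) :
    ENNReal.ofReal a ≤ ∫⁻ t in Set.Ioc (0 : ℝ) 1, ENNReal.ofReal (f t) := by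
  rw [intervalIntegral.integral_of_le zero_le_one] at h
  rw [← ofReal_integral_eq_lintegral_ofReal hf.integrableOn_Ioc (.of_forall hf₀)]
  exact ENNReal.ofReal_le_ofReal h

lemma setLIntegral_Ioc_Ioc_eq {f : Plane → ℝ≥0∞} (hf : Measurable f) (x : Plane) :
    ∫⁻ s in Set.Ioc (0 : ℝ) 1, ∫⁻ t in Set.Ioc (0 : ℝ) 1, f (x + s • e 0 + t • e 1) =
      ∫⁻ y in {y | x ∈ unitBox y}, f y := by
  let T : ℝ × ℝ → Plane := fun p => x + WithLp.toLp 2 ![p.1, p.2]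
  have hT : MeasurePreserving T :=
    (measurePreserving_add_left volume x).comp ((PiLp.volume_preserving_toLp (Fin 2)).comp
      ((volume_preserving_finTwoArrow ℝ).symm _))
  have hT_apply (p : ℝ × ℝ) : x + p.1 • e 0 + p.2 • e 1 = T p := by
    ext i
    fin_cases i <;> simp [T]
  have hpre : T ⁻¹' {y : Plane | x ∈ unitBox y} = Set.Ioc (0 : ℝ) 1 ×ˢ Set.Ioc (0 : ℝ) 1 := by
    ext p
    simp [T, unitBox, Fin.forall_fin_two, add_comm (x _)]
  have hbox : MeasurableSet {y : Plane | x ∈ unitBox y} :=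
    measurable_prodMk_left measurableSet_mem_unitBox
  rw [← setLIntegral_prod (fun p : ℝ × ℝ => f (x + p.1 • e 0 + p.2 • e 1))
    (Measurable.aemeasurable (by simp only [hT_apply]; exact hf.comp hT.measurable))]
  simp only [hT_apply]
  rw [← hpre, ← Measure.volume_eq_prod,
    hT.setLIntegral_comp_preimage hbox hf]

section SobolevInequality

variable {β δ : ℝ}

/-- A bound for `|φ ψ| + |∂_j (φ̄ ψ)|` in terms of covariant derivatives. -/
noncomputable def leibnizDensity (β : ℝ) (j : Fin 2) (φ ψ : testFunctions) (x : Plane) : ℝ :=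
  ‖φ.1 x‖ * ‖ψ.1 x‖ +
    (‖φ.1 x‖ * ‖(covMomentum β j ψ).1 x‖ + ‖(covMomentum β j φ).1 x‖ * ‖ψ.1 x‖)

/-- The density on the right-hand side of the covariant Sobolev inequality for `|φ|²`; the small
parameter `δ` multiplies the second order term. -/
noncomputable def sobolevDensity (β δ : ℝ) (φ : testFunctions) (x : Plane) : ℝ :=
  (3 + δ⁻¹) * ‖φ.1 x‖ ^ 2 + 2 * ‖(covMomentum β 0 φ).1 x‖ ^ 2 +
    2 * ‖(covMomentum β 1 φ).1 x‖ ^ 2 + δ * ‖(covMomentum β 1 (covMomentum β 0 φ)).1 x‖ ^ 2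

lemma continuous_test (φ : testFunctions) : Continuous φ.1 := φ.2.1.continuous

lemma leibnizDensity_nonneg (j : Fin 2) (φ ψ : testFunctions) (x : Plane) :
    0 ≤ leibnizDensity β j φ ψ x := by
  unfold leibnizDensity
  positivity

lemma continuous_leibnizDensity (j : Fin 2) (φ ψ : testFunctions) :
    Continuous (leibnizDensity β j φ ψ) :=
  ((continuous_test φ).norm.mul (continuous_test ψ).norm).add
    (((continuous_test φ).norm.mul (continuous_test _).norm).add
      ((continuous_test _).norm.mul (continuous_test ψ).norm))

lemma sobolevDensity_nonneg (hδ : 0 < δ) (φ : testFunctions) (x : Plane) :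
    0 ≤ sobolevDensity β δ φ x := by
  unfold sobolevDensity
  positivity

lemma continuous_sobolevDensity (φ : testFunctions) : Continuous (sobolevDensity β δ φ) := by
  have h (χ : testFunctions) (c : ℝ) : Continuous fun x => c * ‖χ.1 x‖ ^ 2 :=
    continuous_const.mul ((continuous_test χ).norm.pow 2)
  exact (((h _ _).add (h _ _)).add (h _ _)).add (h _ _)

lemma norm_mul_norm_le_lintegral_leibnizDensity (j : Fin 2) (φ ψ : testFunctions) (x : Plane) :
    ENNReal.ofReal (‖φ.1 x‖ * ‖ψ.1 x‖) ≤
      ∫⁻ t in Set.Ioc (0 : ℝ) 1, ENNReal.ofReal (leibnizDensity β j φ ψ (x + t • e j)) := by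
  have hline : Continuous fun t : ℝ => x + t • e j := by fun_prop
  refine ofReal_le_lintegral_of_le_integral ((continuous_leibnizDensity j φ ψ).comp hline)
    (fun t => leibnizDensity_nonneg j φ ψ _) ?_
  set f : Plane → ℂ := fun y => conj (φ.1 y) * ψ.1 y
  set f' : Plane → ℂ := fun y => Complex.I *
    (conj (φ.1 y) * (covMomentum β j ψ).1 y - conj ((covMomentum β j φ).1 y) * ψ.1 y)
  have hf (y : Plane) : HasLineDerivAt ℝ f (f' y) y (e j) :=
    hasLineDerivAt_conj_mul (hasLineDerivAt_test j φ y) (hasLineDerivAt_test j ψ y)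
  have hmul (φ ψ : testFunctions) : Continuous fun y => conj (φ.1 y) * ψ.1 y :=
    (Complex.continuous_conj.comp (continuous_test φ)).mul (continuous_test ψ)
  have hf' : Continuous f' := continuous_const.mul ((hmul _ _).sub (hmul _ _))
  have hnorm (y : Plane) : ‖f y‖ + ‖f' y‖ ≤ leibnizDensity β j φ ψ y := by
    refine add_le_add (by simp [f]) ?_
    rw [norm_mul, Complex.norm_I, one_mul]
    exact (norm_sub_le _ _).trans_eq (by simp only [norm_mul, RCLike.norm_conj])
  calc ‖φ.1 x‖ * ‖ψ.1 x‖ = ‖f (x + (0 : ℝ) • e j)‖ := by simp [f]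
    _ ≤ ∫ t in (0 : ℝ)..1, (‖f (x + t • e j)‖ + ‖f' (x + t • e j)‖) :=
      norm_le_integral_norm_add_norm (hasDerivAt_comp_line hf x) (hf'.comp hline)
    _ ≤ ∫ t in (0 : ℝ)..1, leibnizDensity β j φ ψ (x + t • e j) :=
      intervalIntegral.integral_mono_on zero_le_one
        ((((hmul φ ψ).comp hline).norm.add (hf'.comp hline).norm).intervalIntegrable _ _)
        (((continuous_leibnizDensity j φ ψ).comp hline).intervalIntegrable _ _)
        fun t _ => hnorm _

lemma leibnizDensity_add_le_sobolevDensity (hδ : 0 < δ) (φ : testFunctions) (x : Plane) :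
    leibnizDensity β 1 φ φ x + 2 * leibnizDensity β 1 φ (covMomentum β 0 φ) x ≤
      sobolevDensity β δ φ x := by
  simp only [leibnizDensity, sobolevDensity]
  set a := ‖φ.1 x‖
  set p := ‖(covMomentum β 0 φ).1 x‖
  set q := ‖(covMomentum β 1 φ).1 x‖
  set r := ‖(covMomentum β 1 (covMomentum β 0 φ)).1 x‖
  have har : 2 * (a * r) ≤ δ⁻¹ * a ^ 2 + δ * r ^ 2 := by
    have h : δ⁻¹ * a ^ 2 + δ * r ^ 2 - 2 * (a * r) = δ⁻¹ * (a - δ * r) ^ 2 := by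
      field_simp
      ring
    have : 0 ≤ δ⁻¹ * (a - δ * r) ^ 2 := by positivity
    linarith
  nlinarith [sq_nonneg (a - q), sq_nonneg (a - p), sq_nonneg (p - q)]

/-- Integrate along `e 0`, then along `e 1`: only the mixed second derivative appears. -/
lemma norm_sq_le_lintegral_sobolevDensity (hδ : 0 < δ) (φ : testFunctions) (x : Plane) :
    ENNReal.ofReal (‖φ.1 x‖ ^ 2) ≤
      ∫⁻ y in {y | x ∈ unitBox y}, ENNReal.ofReal (sobolevDensity β δ φ y) := by
  have hm (ψ : testFunctions) (y : Plane) :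
      Measurable fun t : ℝ => ENNReal.ofReal (leibnizDensity β 1 φ ψ (y + t • e 1)) :=
    ((continuous_leibnizDensity 1 φ ψ).comp (by fun_prop)).measurable.ennreal_ofReal
  rw [← setLIntegral_Ioc_Ioc_eq (continuous_sobolevDensity φ).measurable.ennreal_ofReal, pow_two]
  refine (norm_mul_norm_le_lintegral_leibnizDensity (β := β) 0 φ φ x).trans
    (lintegral_mono fun s => ?_)
  set y := x + s • e 0
  have hdouble (c : ℝ) : 2 * ENNReal.ofReal c = ENNReal.ofReal (2 * c) := by
    rw [ENNReal.ofReal_mul zero_le_two, ENNReal.ofReal_ofNat]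
  calc ENNReal.ofReal (leibnizDensity β 0 φ φ y)
      = ENNReal.ofReal (‖φ.1 y‖ * ‖φ.1 y‖) +
          2 * ENNReal.ofReal (‖φ.1 y‖ * ‖(covMomentum β 0 φ).1 y‖) := by
        rw [leibnizDensity, mul_comm ‖(covMomentum β 0 φ).1 y‖, ← two_mul,
          ENNReal.ofReal_add (by positivity) (by positivity), hdouble]
    _ ≤ (∫⁻ t in Set.Ioc (0 : ℝ) 1, ENNReal.ofReal (leibnizDensity β 1 φ φ (y + t • e 1))) +
          2 * ∫⁻ t in Set.Ioc (0 : ℝ) 1,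
            ENNReal.ofReal (leibnizDensity β 1 φ (covMomentum β 0 φ) (y + t • e 1)) :=
        add_le_add (norm_mul_norm_le_lintegral_leibnizDensity 1 φ φ y)
          (mul_le_mul_right (norm_mul_norm_le_lintegral_leibnizDensity 1 φ _ y) 2)
    _ = ∫⁻ t in Set.Ioc (0 : ℝ) 1, (ENNReal.ofReal (leibnizDensity β 1 φ φ (y + t • e 1)) +
          2 * ENNReal.ofReal (leibnizDensity β 1 φ (covMomentum β 0 φ) (y + t • e 1))) := by
        rw [lintegral_add_left (hm _ _), lintegral_const_mul _ (hm _ _)]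
    _ ≤ ∫⁻ t in Set.Ioc (0 : ℝ) 1, ENNReal.ofReal (sobolevDensity β δ φ (y + t • e 1)) := by
        refine lintegral_mono fun t => ?_
        rw [hdouble, ← ENNReal.ofReal_add (leibnizDensity_nonneg _ _ _ _)
            (mul_nonneg zero_le_two (leibnizDensity_nonneg _ _ _ _))]
        exact ENNReal.ofReal_le_ofReal (leibnizDensity_add_le_sobolevDensity hδ φ _)

lemma lintegral_enorm_sq_eq {f : Plane → ℂ} (hf : MemLp f 2 (volume : Measure Plane)) :
    ∫⁻ x, ‖f x‖ₑ ^ 2 = ENNReal.ofReal (‖hf.toLp f‖ ^ 2) := by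
  rw [Lp.norm_toLp, ENNReal.ofReal_pow ENNReal.toReal_nonneg, ENNReal.ofReal_toReal hf.2.ne]
  simpa using (eLpNorm_nnreal_pow_eq_lintegral (f := f) (μ := (volume : Measure Plane)) (p := 2)
    two_ne_zero).symm

lemma integral_norm_sq_test (φ : testFunctions) : ∫ r, ‖φ.1 r‖ ^ 2 = ‖testToL2 φ‖ ^ 2 := by
  have h := integral_eq_lintegral_of_nonneg_ae (.of_forall fun r => sq_nonneg ‖φ.1 r‖)
    ((continuous_test φ).norm.pow 2).aestronglyMeasurable (μ := (volume : Measure Plane))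
  simp only [ENNReal.ofReal_pow (norm_nonneg _), ofReal_norm] at h
  rw [h, lintegral_enorm_sq_eq (memLp_test φ), ENNReal.toReal_ofReal (sq_nonneg _), testToL2_apply]

lemma lintegral_sobolevDensity (hδ : 0 < δ) (φ : testFunctions) :
    ∫⁻ y, ENNReal.ofReal (sobolevDensity β δ φ y) =
      ENNReal.ofReal ((3 + δ⁻¹) * ‖testToL2 φ‖ ^ 2 +
        2 * ‖testToL2 (covMomentum β 0 φ)‖ ^ 2 + 2 * ‖testToL2 (covMomentum β 1 φ)‖ ^ 2 +
        δ * ‖testToL2 (covMomentum β 1 (covMomentum β 0 φ))‖ ^ 2) := by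
  have hi (χ : testFunctions) (c : ℝ) : Integrable (fun r => c * ‖χ.1 r‖ ^ 2) :=
    (memLp_test χ).norm.integrable_sq.const_mul c
  have h₂ := (hi φ (3 + δ⁻¹)).fun_add (hi (covMomentum β 0 φ) 2)
  have h₃ := h₂.fun_add (hi (covMomentum β 1 φ) 2)
  have h₄ : Integrable (sobolevDensity β δ φ) :=
    h₃.fun_add (hi (covMomentum β 1 (covMomentum β 0 φ)) δ)
  rw [← ofReal_integral_eq_lintegral_ofReal h₄ (.of_forall (sobolevDensity_nonneg hδ φ))]
  simp only [sobolevDensity]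
  rw [integral_add h₃ (hi _ _), integral_add h₂ (hi _ _), integral_add (hi _ _) (hi _ _)]
  simp only [integral_const_mul, integral_norm_sq_test]

end SobolevInequality

/-! ### Multiplication by a uniformly locally square integrable potential -/

lemma lintegral_mul_le_of_forall_setLIntegral_le {X Y : Type*} [MeasurableSpace X]
    [MeasurableSpace Y] {μ : Measure X} {ν : Measure Y} [SFinite μ] [SFinite ν] {S : Set (X × Y)}
    (hS : MeasurableSet S) {W F : X → ℝ≥0∞} {G : Y → ℝ≥0∞} (hW : AEMeasurable W μ)
    (hG : Measurable G) {c : ℝ≥0∞} (hWc : ∀ y, ∫⁻ x in {x | (x, y) ∈ S}, W x ∂μ ≤ c)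
    (hF : ∀ x, F x ≤ ∫⁻ y in {y | (x, y) ∈ S}, G y ∂ν) :
    ∫⁻ x, W x * F x ∂μ ≤ c * ∫⁻ y, G y ∂ν := by
  have hindicator (x : X) (y : Y) : S.indicator (fun p => W p.1 * G p.2) (x, y) =
      {y | (x, y) ∈ S}.indicator (fun y => W x * G y) y := rfl
  have hswap (x : X) (y : Y) : S.indicator (fun p => W p.1 * G p.2) (x, y) =
      {x | (x, y) ∈ S}.indicator (fun x => W x * G y) x := rfl
  have hjoint : AEMeasurable (S.indicator fun p => W p.1 * G p.2) (μ.prod ν) :=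
    ((hW.comp_quasiMeasurePreserving Measure.quasiMeasurePreserving_fst).mul
      (hG.comp measurable_snd).aemeasurable).indicator hS
  have hx (x : X) : MeasurableSet {y | (x, y) ∈ S} := measurable_prodMk_left hS
  have hy (y : Y) : MeasurableSet {x | (x, y) ∈ S} := measurable_prodMk_right hS
  calc ∫⁻ x, W x * F x ∂μ ≤ ∫⁻ x, ∫⁻ y, S.indicator (fun p => W p.1 * G p.2) (x, y) ∂ν ∂μ := by
        refine lintegral_mono fun x => ?_
        simp only [hindicator]
        rw [lintegral_indicator (hx x), lintegral_const_mul _ hG]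
        exact mul_le_mul_right (hF x) _
    _ = ∫⁻ y, ∫⁻ x, S.indicator (fun p => W p.1 * G p.2) (x, y) ∂μ ∂ν :=
        lintegral_lintegral_swap hjoint
    _ ≤ ∫⁻ y, c * G y ∂ν := by
        refine lintegral_mono fun y => ?_
        simp only [hswap]
        rw [lintegral_indicator (hy y), lintegral_mul_const'' _ hW.restrict]
        exact mul_le_mul_left (hWc y) _
    _ = c * ∫⁻ y, G y ∂ν := lintegral_const_mul _ hG

section Potential

variable {V : Plane → ℝ}

lemma exists_norm_sq_potential_mul_le (hV : IsLocallyL2 V) (hVu : IsUniformlyLocallyL2 V) :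
    ∃ N : ℝ, 0 < N ∧ ∀ (β δ : ℝ), 0 < δ → ∀ φ : testFunctions,
      ‖(memLp_potential_mul hV φ.2.1.continuous φ.2.2).toLp _‖ ^ 2 ≤
        N * ((3 + δ⁻¹) * ‖testToL2 φ‖ ^ 2 +
          2 * ‖testToL2 (covMomentum β 0 φ)‖ ^ 2 + 2 * ‖testToL2 (covMomentum β 1 φ)‖ ^ 2 +
          δ * ‖testToL2 (covMomentum β 1 (covMomentum β 0 φ))‖ ^ 2) := by
  obtain ⟨N, hN⟩ := hVu
  have hVN (y : Plane) : ∫⁻ z in unitBox y, ‖V z‖ₑ ^ 2 ≤ ENNReal.ofReal (N ^ 2 + 1) := by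
    have h := eLpNorm_nnreal_pow_eq_lintegral (f := V) (μ := volume.restrict (unitBox y)) (p := 2)
      two_ne_zero
    simp only [NNReal.coe_ofNat, ENNReal.rpow_ofNat, ENNReal.coe_ofNat] at h
    rw [← h]
    calc eLpNorm V 2 (volume.restrict (unitBox y)) ^ 2 ≤ (N : ℝ≥0∞) ^ 2 := by
          gcongr
          exact hN y
      _ = ENNReal.ofReal ((N : ℝ) ^ 2) := by
          rw [ENNReal.ofReal_pow N.coe_nonneg, ENNReal.ofReal_coe_nnreal]
      _ ≤ ENNReal.ofReal (N ^ 2 + 1) := ENNReal.ofReal_le_ofReal (by linarith)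
  refine ⟨N ^ 2 + 1, by positivity, fun β δ hδ φ => ?_⟩
  have h := lintegral_mul_le_of_forall_setLIntegral_le measurableSet_mem_unitBox
    (hV.aestronglyMeasurable.enorm.pow_const 2)
    (continuous_sobolevDensity φ).measurable.ennreal_ofReal hVN
    (norm_sq_le_lintegral_sobolevDensity (β := β) hδ φ)
  have hVφ : ∫⁻ x, ‖V x‖ₑ ^ 2 * ENNReal.ofReal (‖φ.1 x‖ ^ 2) =
      ∫⁻ x, ‖(V x : ℂ) * φ.1 x‖ₑ ^ 2 := by
    refine lintegral_congr fun x => ?_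
    rw [enorm_mul, mul_pow, ENNReal.ofReal_pow (norm_nonneg _), ofReal_norm,
      ← ofReal_norm (V x : ℂ), Complex.norm_real, ofReal_norm]
  rw [hVφ, lintegral_enorm_sq_eq (memLp_potential_mul hV φ.2.1.continuous φ.2.2),
    lintegral_sobolevDensity hδ, ← ENNReal.ofReal_mul (by positivity)] at h
  exact (ENNReal.ofReal_le_ofReal_iff (by positivity)).1 h

theorem isInfinitesimallyBounded_potential_mul (β : ℝ) (hV : IsLocallyL2 V)
    (hVu : IsUniformlyLocallyL2 V) :
    IsInfinitesimallyBounded testToL2 (testToL2 ∘ₗ covLaplacian β) fun φ =>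
      (memLp_potential_mul hV φ.2.1.continuous φ.2.2).toLp _ := by
  obtain ⟨N, hN, hVN⟩ := exists_norm_sq_potential_mul_le hV hVu
  refine .of_sq_le fun ε hε => ?_
  set δ := ε / (3 * N) with hδ
  have hδ₀ : 0 < δ := by positivity
  have hNδ : N * (3 * δ) = ε := by
    rw [hδ]
    field_simp
  refine ⟨N * (3 + 2 * δ⁻¹ + 2 * δ * β ^ 2), fun φ => (hVN β δ hδ₀ φ).trans ?_⟩
  have hpq := sum_norm_sq_covMomentum_le (β := β) φ
  have hr := norm_covMomentum_covMomentum_le (β := β) 1 0 φ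
  rw [LinearMap.comp_apply]
  set n := ‖testToL2 φ‖
  set l := ‖testToL2 (covLaplacian β φ)‖
  set r := ‖testToL2 (covMomentum β 1 (covMomentum β 0 φ))‖
  have hnl : 2 * (n * l) ≤ δ⁻¹ * n ^ 2 + δ * l ^ 2 := by
    have h : δ⁻¹ * n ^ 2 + δ * l ^ 2 - 2 * (n * l) = δ⁻¹ * (n - δ * l) ^ 2 := by
      field_simp
      ring
    have : 0 ≤ δ⁻¹ * (n - δ * l) ^ 2 := by positivity
    linarith
  have hr' : r ^ 2 ≤ 2 * l ^ 2 + 2 * (β ^ 2 * n ^ 2) := by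
    calc r ^ 2 ≤ (l + |β| * n) ^ 2 := pow_le_pow_left₀ (norm_nonneg _) hr 2
      _ ≤ 2 * (l ^ 2 + (|β| * n) ^ 2) := add_sq_le
      _ = 2 * l ^ 2 + 2 * (β ^ 2 * n ^ 2) := by rw [mul_pow, sq_abs]; ring
  rw [← hNδ]
  nlinarith [mul_le_mul_of_nonneg_left hr' hδ₀.le]

end Potential

/-! ### Functions with bounded derivatives -/

section IsCb

variable {n : ℕ∞} {f g : Plane → ℝ}

lemma IsCb.of_le {k : ℕ∞} (hf : IsCb n f) (hk : k ≤ n) : IsCb k f :=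
  ⟨hf.1.of_le (by exact_mod_cast hk), fun i hi => hf.2 i (hi.trans hk)⟩

lemma IsCb.add (hf : IsCb n f) (hg : IsCb n g) : IsCb n fun r => f r + g r := by
  refine ⟨hf.1.add hg.1, fun k hk => ?_⟩
  obtain ⟨C, hC⟩ := hf.2 k hk
  obtain ⟨D, hD⟩ := hg.2 k hk
  have hk' : (k : WithTop ℕ∞) ≤ n := by exact_mod_cast hk
  refine ⟨C + D, fun x => ?_⟩
  rw [fun_iteratedFDeriv_add_apply (hf.1.of_le hk').contDiffAt (hg.1.of_le hk').contDiffAt]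
  exact (norm_add_le _ _).trans (add_le_add (hC x) (hD x))

lemma IsCb.const_mul (c : ℝ) (hf : IsCb n f) : IsCb n fun r => c * f r := by
  refine ⟨contDiff_const.mul hf.1, fun k hk => ?_⟩
  obtain ⟨C, hC⟩ := hf.2 k hk
  have hk' : (k : WithTop ℕ∞) ≤ n := by exact_mod_cast hk
  refine ⟨‖c‖ * C, fun x => ?_⟩
  change ‖iteratedFDeriv ℝ k (fun r => c • f r) x‖ ≤ _
  rw [iteratedFDeriv_const_smul_apply' (hf.1.of_le hk').contDiffAt, norm_smul]
  gcongr
  exact hC x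

lemma IsCb.exists_norm_le (hf : IsCb n f) : ∃ C, ∀ x, ‖f x‖ ≤ C := by
  simpa only [norm_iteratedFDeriv_zero] using hf.2 0 zero_le

lemma IsCb.exists_boundedContinuousFunction (hf : IsCb n f) :
    ∃ g : Plane →ᵇ ℂ, ∀ r, g r = f r := by
  obtain ⟨C, hC⟩ := hf.exists_norm_le
  exact ⟨.ofNormedAddCommGroup (fun r => (f r : ℂ))
    (Complex.continuous_ofReal.comp hf.1.continuous) C
    fun r => (Complex.norm_real _).trans_le (hC r), fun r => rfl⟩

lemma IsCb.exists_boundedContinuousFunction_fderiv (hf : IsCb n f) (hn : 1 ≤ n) (v : Plane) :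
    ∃ g : Plane →ᵇ ℂ, ∀ r, g r = fderiv ℝ f r v := by
  obtain ⟨C, hC⟩ : ∃ C, ∀ x, ‖fderiv ℝ f x‖ ≤ C := by
    simpa only [norm_iteratedFDeriv_one] using hf.2 1 (by exact_mod_cast hn)
  have hcont : Continuous fun r => fderiv ℝ f r v :=
    (hf.1.continuous_fderiv (by exact_mod_cast (zero_lt_one.trans_le hn).ne')).clm_apply
      continuous_const
  exact ⟨.ofNormedAddCommGroup (fun r => (fderiv ℝ f r v : ℂ))
    (Complex.continuous_ofReal.comp hcont) (C * ‖v‖) fun r =>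
      (Complex.norm_real _).trans_le ((fderiv ℝ f r).le_of_opNorm_le (hC r) v), fun r => rfl⟩

end IsCb

/-! ### The Hamiltonian as a perturbation of the covariant Laplacian -/

lemma memLp_mul_test (b : Plane →ᵇ ℂ) (φ : testFunctions) :
    MemLp (fun r => b r * φ.1 r) 2 (volume : Measure Plane) :=
  (b.continuous.mul (continuous_test φ)).memLp_of_hasCompactSupport φ.2.2.mul_left

lemma norm_toLp_mul_test_le (b : Plane →ᵇ ℂ) (φ : testFunctions) :
    ‖(memLp_mul_test b φ).toLp _‖ ≤ ‖b‖ * ‖testToL2 φ‖ := by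
  refine Lp.norm_le_mul_norm_of_ae_le_mul ?_
  filter_upwards [(memLp_mul_test b φ).coeFn_toLp, (memLp_test φ).coeFn_toLp] with r h₁ h₂
  rw [testToL2_apply, h₁, h₂, norm_mul]
  exact mul_le_mul_of_nonneg_right (b.norm_coe_le_norm r) (norm_nonneg _)

section RelativeBound

variable {m ħ κ β : ℝ} {A : Plane → Plane} {V : Plane → ℝ} {a : Fin 2 → Plane → ℝ}

lemma isInfinitesimallyBounded_testToL2 :
    IsInfinitesimallyBounded testToL2 (testToL2 ∘ₗ covLaplacian β) testToL2 :=
  fun ε hε => ⟨1, fun φ => by rw [one_mul]; exact le_add_of_nonneg_left (by positivity)⟩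

lemma isInfinitesimallyBounded_covMomentum (j : Fin 2) :
    IsInfinitesimallyBounded testToL2 (testToL2 ∘ₗ covLaplacian β) fun φ =>
      testToL2 (covMomentum β j φ) := by
  refine .of_sq_le fun ε hε => ⟨ε⁻¹, fun φ => ?_⟩
  have h := sum_norm_sq_covMomentum_le (β := β) φ
  rw [LinearMap.comp_apply]
  set n := ‖testToL2 φ‖
  set l := ‖testToL2 (covLaplacian β φ)‖
  have hnl : ε * l ^ 2 + ε⁻¹ * n ^ 2 - 2 * (n * l) = ε⁻¹ * (n - ε * l) ^ 2 := by
    field_simp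
    ring
  have hsq : 0 ≤ ε⁻¹ * (n - ε * l) ^ 2 := by positivity
  have hnl₀ : 0 ≤ n * l := by positivity
  fin_cases j <;> dsimp only [Fin.zero_eta, Fin.mk_one] <;>
    linarith [sq_nonneg ‖testToL2 (covMomentum β 0 φ)‖, sq_nonneg ‖testToL2 (covMomentum β 1 φ)‖]

lemma IsInfinitesimallyBounded.mul_test {S : testFunctions → testFunctions}
    (hS : IsInfinitesimallyBounded testToL2 (testToL2 ∘ₗ covLaplacian β) fun φ => testToL2 (S φ))
    (b : Plane →ᵇ ℂ) :
    IsInfinitesimallyBounded testToL2 (testToL2 ∘ₗ covLaplacian β) fun φ =>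
      (memLp_mul_test b (S φ)).toLp _ :=
  hS.of_norm_le (a := ‖b‖) (b := 0) fun φ => by
    rw [zero_mul, add_zero]
    exact norm_toLp_mul_test_le b (S φ)

lemma momentum_eq_covMomentum_sub (hAa : ∀ j r, κ * A r j = ħ * uniformPotential β r j + a j r)
    (j : Fin 2) (φ : testFunctions) :
    momentum ħ κ A j φ.1 =
      fun r => (ħ : ℂ) * (covMomentum β j φ).1 r - (a j r : ℂ) * φ.1 r := by
  funext r
  rw [momentum, covMomentum_apply, ← Complex.ofReal_mul, hAa]
  push_cast
  ring

lemma momentum_momentum_eq (hAa : ∀ j r, κ * A r j = ħ * uniformPotential β r j + a j r)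
    (ha : ∀ j, IsCb 1 (a j)) (j : Fin 2) (φ : testFunctions) (r : Plane) :
    momentum ħ κ A j (momentum ħ κ A j φ.1) r =
      (ħ : ℂ) ^ 2 * (covMomentum β j (covMomentum β j φ)).1 r +
        (-2 * ħ * a j r) * (covMomentum β j φ).1 r +
        (Complex.I * ħ * (fderiv ℝ (a j) r (e j) : ℂ) + (a j r : ℂ) ^ 2) * φ.1 r := by
  have hdiff (χ : testFunctions) : HasFDerivAt χ.1 (fderiv ℝ χ.1 r) r :=
    (χ.2.1.differentiable (by simp) r).hasFDerivAt
  have hdiff_a := Complex.ofRealCLM.hasFDerivAt.comp r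
    ((ha j).1.differentiable (by simp) r).hasFDerivAt
  have hfderiv : fderiv ℝ (momentum ħ κ A j φ.1) r (e j) =
      (ħ : ℂ) * fderiv ℝ (covMomentum β j φ).1 r (e j) - ((a j r : ℂ) * fderiv ℝ φ.1 r (e j) +
        (fderiv ℝ (a j) r (e j) : ℂ) * φ.1 r) := by
    rw [momentum_eq_covMomentum_sub hAa]
    have h := ((hdiff (covMomentum β j φ)).const_mul (ħ : ℂ)).sub (hdiff_a.mul (hdiff φ))
    refine (congrArg (fun L => L (e j)) h.fderiv).trans ?_
    simp [mul_comm (φ.1 r)]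
  have hκ : (κ : ℂ) * (A r j : ℂ) = ħ * uniformPotential β r j + a j r := by
    exact_mod_cast congrArg (fun x : ℝ => (x : ℂ)) (hAa j r)
  rw [momentum, hfderiv, momentum_eq_covMomentum_sub hAa]
  linear_combination (-(ħ : ℂ) ^ 2) * covMomentum_apply j (covMomentum β j φ) r +
    (ħ * a j r : ℂ) * covMomentum_apply j φ r -
    (ħ * (covMomentum β j φ).1 r - a j r * φ.1 r) * hκ

theorem isInfinitesimallyBounded_hamiltonianOnTest_sub
    (hAa : ∀ j r, κ * A r j = ħ * uniformPotential β r j + a j r) (ha : ∀ j, IsCb 1 (a j))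
    (hA : ∀ j, ContDiff ℝ 1 (fun r => A r j)) (hV : IsLocallyL2 V) (hVu : IsUniformlyLocallyL2 V) :
    IsInfinitesimallyBounded testToL2 (testToL2 ∘ₗ covLaplacian β) fun φ =>
      hamiltonianOnTest m ħ κ A V hA hV φ -
        ((ħ ^ 2 / (2 * m) : ℝ) : ℂ) • (testToL2 ∘ₗ covLaplacian β) φ := by
  choose α hα using fun j => (ha j).exists_boundedContinuousFunction
  choose α' hα' using fun j => (ha j).exists_boundedContinuousFunction_fderiv le_rfl (e j)
  let b (j : Fin 2) : Plane →ᵇ ℂ := (-ħ / m : ℂ) • α j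
  let d (j : Fin 2) : Plane →ᵇ ℂ :=
    (1 / (2 * m) : ℂ) • ((Complex.I * ħ) • α' j + α j * α j)
  have hdecomp (φ : testFunctions) : hamiltonianOnTest m ħ κ A V hA hV φ -
      ((ħ ^ 2 / (2 * m) : ℝ) : ℂ) • (testToL2 ∘ₗ covLaplacian β) φ =
      ∑ j, ((memLp_mul_test (b j) (covMomentum β j φ)).toLp _ +
        (memLp_mul_test (d j) φ).toLp _) +
      (memLp_potential_mul hV φ.2.1.continuous φ.2.2).toLp _ := by
    rw [sub_eq_iff_eq_add, LinearMap.comp_apply, testToL2_apply, Fin.sum_univ_two]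
    simp only [← MemLp.toLp_add, ← MemLp.toLp_const_smul]
    refine MemLp.toLp_congr (memLp_hamiltonianExpr hA hV φ.2) _ (.of_forall fun r => ?_)
    simp only [covLaplacian_apply, Submodule.coe_add, Pi.add_apply, Pi.smul_apply, smul_eq_mul,
      hamiltonianExpr, Fin.sum_univ_two, momentum_momentum_eq hAa ha, b, d,
      BoundedContinuousFunction.smul_apply, BoundedContinuousFunction.add_apply,
      BoundedContinuousFunction.mul_apply, hα, hα']
    push_cast
    ring
  simp only [hdecomp]
  refine (IsInfinitesimallyBounded.sum fun j _ => ?_).add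
    (isInfinitesimallyBounded_potential_mul β hV hVu)
  exact ((isInfinitesimallyBounded_covMomentum j).mul_test (b j)).add
    (isInfinitesimallyBounded_testToL2.mul_test (S := id) (d j))

end RelativeBound

/-! ### Magnetic Sobolev spaces -/

lemma mem_sobolevOf_of_forall {P : Fin 2 → 𝓢'(Plane, ℂ) →L[ℂ] 𝓢'(Plane, ℂ)} {ψ : L2}
    (h₁ : ∀ j, ∃ g : L2, P j (ψ : 𝓢'(Plane, ℂ)) = (g : 𝓢'(Plane, ℂ)))
    (h₂ : ∀ j k, ∃ g : L2, P j (P k (ψ : 𝓢'(Plane, ℂ))) = (g : 𝓢'(Plane, ℂ))) :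
    ψ ∈ sobolevOf P := by
  intro n₁ n₂ hn
  have hn₁ : n₁ ≤ 2 := by omega
  have hn₂ : n₂ ≤ 2 := by omega
  interval_cases n₁ <;> interval_cases n₂ <;> first | omega | skip
  · exact ⟨ψ, rfl⟩
  · simpa only [pow_zero, one_mul, pow_one] using h₁ 1
  · simpa only [pow_zero, one_mul, pow_two, mul_apply_eq_comp] using h₂ 1 1
  · simpa only [pow_zero, mul_one, pow_one] using h₁ 0
  · simpa only [pow_one, mul_apply_eq_comp] using h₂ 0 1
  · simpa only [pow_zero, mul_one, pow_two, mul_apply_eq_comp] using h₂ 0 0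

lemma magneticD_zero : magneticD 0 = partialD := by
  funext j
  have hzero : (fun x : Plane => Complex.I * (uniformPotential 0 x j : ℂ)) = fun _ => 0 := by
    funext x
    fin_cases j <;> simp [uniformPotential]
  ext f χ
  simp [magneticD, hzero]

section Magnetic

variable {β : ℝ}

lemma hasTemperateGrowth_uniformPotential (β : ℝ) (j : Fin 2) :
    Function.HasTemperateGrowth fun x : Plane => Complex.I * (uniformPotential β x j : ℂ) := by
  have hproj (c : ℝ) (k : Fin 2) :
      Function.HasTemperateGrowth fun x : Plane => Complex.I * ((c * x k : ℝ) : ℂ) :=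
    ((ContinuousLinearMap.mul ℝ ℂ Complex.I) ∘L Complex.ofRealCLM ∘L
      (c • (EuclideanSpace.proj k : Plane →L[ℝ] ℝ))).hasTemperateGrowth
  fin_cases j
  exacts [hproj (-(β / 2)) 1, hproj (β / 2) 0]

lemma toTemperedDistribution_eq_integral (f : L2) (χ : 𝓢(Plane, ℂ)) :
    (f : 𝓢'(Plane, ℂ)) χ = ∫ x, χ x * f x := by
  rw [Lp.toTemperedDistribution_apply]
  rfl

lemma magneticD_apply (j : Fin 2) (f : L2) (χ : 𝓢(Plane, ℂ)) :
    magneticD β j (f : 𝓢'(Plane, ℂ)) χ =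
      ∫ x, (-fderiv ℝ χ x (e j) - Complex.I * uniformPotential β x j * χ x) * f x := by
  have hdual : magneticD β j (f : 𝓢'(Plane, ℂ)) χ = (f : 𝓢'(Plane, ℂ))
      (-∂_{e j} χ - SchwartzMap.smulLeftCLM ℂ
        (fun x => Complex.I * (uniformPotential β x j : ℂ)) χ) := by
    rw [map_sub]
    rfl
  rw [hdual, toTemperedDistribution_eq_integral]
  congr with x
  rw [_root_.sub_apply, _root_.neg_apply,
    SchwartzMap.smulLeftCLM_apply_apply (hasTemperateGrowth_uniformPotential β j),
    SchwartzMap.lineDerivOp_apply_eq_fderiv, smul_eq_mul]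

lemma I_mul_conj_momentum (j : Fin 2) (φ : Plane → ℂ) (x : Plane) :
    Complex.I * conj (momentum 1 1 (uniformPotential β) j φ x) =
      -fderiv ℝ (fun y => conj (φ y)) x (e j) -
        Complex.I * uniformPotential β x j * conj (φ x) := by
  rw [fderiv_conj_apply, momentum]
  simp only [map_sub, map_mul, map_neg, Complex.conj_I, Complex.conj_ofReal, Complex.ofReal_one,
    map_one]
  linear_combination conj (fderiv ℝ φ x (e j)) * Complex.I_sq

lemma magneticD_testToL2 (j : Fin 2) (φ : testFunctions) :
    magneticD β j (testToL2 φ : 𝓢'(Plane, ℂ)) =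
      (testToL2 (Complex.I • covMomentum β j φ) : 𝓢'(Plane, ℂ)) := by
  ext χ
  let P := momentum 1 1 (uniformPotential β) j
  have hparts : ∫ x, conj (P φ.1 x) * conj (χ x) =
      ∫ x, conj (φ.1 x) * P (fun y => conj (χ y)) x :=
    integral_conj_momentum_mul (contDiff_uniformPotential (n := 1) β j).continuous
      (φ.2.1.of_le (by simp)) (contDiff_conj (χ.smooth 1)) φ.2.2
  rw [magneticD_apply, toTemperedDistribution_eq_integral]
  calc ∫ x, (-fderiv ℝ χ x (e j) - Complex.I * uniformPotential β x j * χ x) * testToL2 φ x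
      = ∫ x, Complex.I * conj (conj (φ.1 x) * P (fun y => conj (χ y)) x) := by
        refine integral_congr_ae ?_
        filter_upwards [(memLp_test φ).coeFn_toLp] with x hx
        have hP := I_mul_conj_momentum (β := β) j (fun y => conj (χ y)) x
        simp only [Complex.conj_conj] at hP
        rw [testToL2_apply, hx, ← hP, map_mul, Complex.conj_conj]
        ring
    _ = ∫ x, Complex.I * conj (conj (P φ.1 x) * conj (χ x)) := by
        rw [integral_const_mul, integral_const_mul, integral_conj, integral_conj, hparts]
    _ = ∫ x, χ x * testToL2 (Complex.I • covMomentum β j φ) x := by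
        refine integral_congr_ae ?_
        filter_upwards [(memLp_test (Complex.I • covMomentum β j φ)).coeFn_toLp] with x hx
        rw [testToL2_apply, hx, map_mul, Complex.conj_conj, Complex.conj_conj]
        change _ = χ x * (Complex.I * P φ.1 x)
        ring

lemma inner_testToL2_left (φ : testFunctions) (f : L2) :
    inner ℂ (testToL2 φ) f = ∫ y, conj (φ.1 y) * f y := by
  rw [testToL2_apply, ← inner_toLp (memLp_test φ) (Lp.memLp f), Lp.toLp_coeFn]

lemma I_mul_inner_covMomentum_eq {j : Fin 2} {f g : L2}
    (h : magneticD β j (f : 𝓢'(Plane, ℂ)) = (g : 𝓢'(Plane, ℂ))) (φ : testFunctions) :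
    Complex.I * inner ℂ (testToL2 (covMomentum β j φ)) f = inner ℂ (testToL2 φ) g := by
  let χ : 𝓢(Plane, ℂ) := (hasCompactSupport_conj φ.2.2).toSchwartzMap (contDiff_conj φ.2.1)
  have hχ := congrArg (fun T : 𝓢'(Plane, ℂ) => T χ) h
  rw [magneticD_apply, toTemperedDistribution_eq_integral] at hχ
  rw [inner_testToL2_left, inner_testToL2_left, ← integral_const_mul]
  refine Eq.trans (integral_congr_ae (.of_forall fun x => ?_)) hχ
  exact (mul_assoc _ _ _).symm.trans (congrArg (· * f x) (I_mul_conj_momentum j φ.1 x))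

lemma inner_covMomentum_covMomentum_eq {j : Fin 2} {ψ f g : L2}
    (hf : magneticD β j (ψ : 𝓢'(Plane, ℂ)) = (f : 𝓢'(Plane, ℂ)))
    (hg : magneticD β j (f : 𝓢'(Plane, ℂ)) = (g : 𝓢'(Plane, ℂ))) (φ : testFunctions) :
    inner ℂ (testToL2 (covMomentum β j (covMomentum β j φ))) ψ = -inner ℂ (testToL2 φ) g := by
  rw [← I_mul_inner_covMomentum_eq hg, ← I_mul_inner_covMomentum_eq hf, ← mul_assoc,
    Complex.I_mul_I]
  ring

lemma exists_forall_inner_eq_inner_covLaplacian {ψ : L2} (hψ : ψ ∈ magneticSobolevTwo β) :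
    ∃ w : L2, ∀ φ, inner ℂ w (testToL2 φ) = inner ℂ ψ (testToL2 (covLaplacian β φ)) := by
  have hsq (j : Fin 2) : ∃ g : L2, ∀ φ,
      inner ℂ (testToL2 (covMomentum β j (covMomentum β j φ))) ψ = -inner ℂ (testToL2 φ) g := by
    obtain ⟨f, hf⟩ : ∃ f : L2, magneticD β j (ψ : 𝓢'(Plane, ℂ)) = (f : 𝓢'(Plane, ℂ)) := by
      fin_cases j
      exacts [by simpa using hψ 1 0 (by norm_num), by simpa using hψ 0 1 (by norm_num)]
    obtain ⟨g, hg⟩ : ∃ g : L2, magneticD β j (magneticD β j (ψ : 𝓢'(Plane, ℂ))) =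
        (g : 𝓢'(Plane, ℂ)) := by
      fin_cases j
      exacts [by simpa [pow_two] using hψ 2 0 (by norm_num),
        by simpa [pow_two] using hψ 0 2 (by norm_num)]
    exact ⟨g, inner_covMomentum_covMomentum_eq hf (hf ▸ hg)⟩
  choose g hg using hsq
  refine ⟨-(g 0 + g 1), fun φ => ?_⟩
  rw [← inner_conj_symm, ← inner_conj_symm ψ, covLaplacian_apply, map_add, inner_add_left, hg, hg,
    inner_neg_right, inner_add_right, neg_add]

lemma magneticD_eq_of_tendsto {j : Fin 2} {φ : ℕ → testFunctions} {f g : L2}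
    (hf : Tendsto (fun n => testToL2 (φ n)) atTop (𝓝 f))
    (hg : Tendsto (fun n => testToL2 (Complex.I • covMomentum β j (φ n))) atTop (𝓝 g)) :
    magneticD β j (f : 𝓢'(Plane, ℂ)) = (g : 𝓢'(Plane, ℂ)) := by
  let E := Lp.toTemperedDistributionCLM ℂ (volume : Measure Plane) 2
  have hDf : Tendsto (fun n => magneticD β j (E (testToL2 (φ n)))) atTop
      (𝓝 (magneticD β j (E f))) :=
    (((magneticD β j).continuous.comp E.continuous).tendsto f).comp hf
  exact tendsto_nhds_unique (hDf.congr fun n => magneticD_testToL2 j (φ n))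
    ((E.continuous.tendsto g).comp hg)

lemma cauchySeq_covMomentum {φ : ℕ → testFunctions} (hJ : CauchySeq fun n => testToL2 (φ n))
    (hL : CauchySeq fun n => testToL2 (covLaplacian β (φ n))) (j : Fin 2) :
    CauchySeq fun n => testToL2 (covMomentum β j (φ n)) := by
  obtain ⟨C, hC⟩ := isInfinitesimallyBounded_covMomentum (β := β) j 1 one_pos
  exact cauchySeq_of_norm_le (L := testToL2 ∘ₗ covMomentum β j) hC hL hJ

lemma cauchySeq_covMomentum_covMomentum {φ : ℕ → testFunctions}
    (hJ : CauchySeq fun n => testToL2 (φ n))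
    (hL : CauchySeq fun n => testToL2 (covLaplacian β (φ n))) (j k : Fin 2) :
    CauchySeq fun n => testToL2 (covMomentum β j (covMomentum β k (φ n))) :=
  cauchySeq_of_norm_le (L := testToL2 ∘ₗ covMomentum β j ∘ₗ covMomentum β k)
    (K := testToL2 ∘ₗ covLaplacian β) (c₁ := 1) (c₂ := |β|)
    (fun χ => by simpa only [one_mul, LinearMap.comp_apply] using
      norm_covMomentum_covMomentum_le j k χ) hL hJ

lemma mem_magneticSobolevTwo_of_tendsto {ψ : L2} {φ : ℕ → testFunctions}
    (hJ : Tendsto (fun n => testToL2 (φ n)) atTop (𝓝 ψ))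
    (hL : CauchySeq fun n => testToL2 (covLaplacian β (φ n))) : ψ ∈ magneticSobolevTwo β := by
  have hsmul {χ : ℕ → testFunctions} (c : ℂ) (h : CauchySeq fun n => testToL2 (χ n)) :
      CauchySeq fun n => testToL2 (c • χ n) := by
    simpa only [map_smul, Function.comp_def] using (uniformContinuous_const_smul c).comp_cauchySeq h
  choose f hf using fun j => cauchySeq_tendsto_of_complete
    (hsmul Complex.I (cauchySeq_covMomentum hJ.cauchySeq hL j))
  have hD (j : Fin 2) : magneticD β j (ψ : 𝓢'(Plane, ℂ)) = (f j : 𝓢'(Plane, ℂ)) :=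
    magneticD_eq_of_tendsto hJ (hf j)
  refine mem_sobolevOf_of_forall (fun j => ⟨f j, hD j⟩) fun j k => ?_
  obtain ⟨g, hg⟩ := cauchySeq_tendsto_of_complete (hsmul (Complex.I * Complex.I)
    (cauchySeq_covMomentum_covMomentum hJ.cauchySeq hL j k))
  refine ⟨g, (hD k).symm ▸ magneticD_eq_of_tendsto (hf k) ?_⟩
  simpa only [map_smul, mul_smul] using hg

theorem mem_magneticSobolevTwo_iff {ψ : L2} : ψ ∈ magneticSobolevTwo β ↔
    ∃ φ : ℕ → testFunctions, Tendsto (fun n => testToL2 (φ n)) atTop (𝓝 ψ) ∧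
      CauchySeq fun n => testToL2 (covLaplacian β (φ n)) := by
  refine ⟨fun hψ => ?_, fun ⟨φ, hJ, hL⟩ => mem_magneticSobolevTwo_of_tendsto hJ hL⟩
  obtain ⟨w, hw⟩ := exists_forall_inner_eq_inner_covLaplacian hψ
  obtain ⟨φ, hJ, hL⟩ := exists_seq_tendsto_of_forall_inner_eq (K := testToL2 ∘ₗ covLaplacian β)
    covLaplacian_symmetric (z := 1) (c := 1)
    (fun φ => by simpa only [one_mul] using
      mul_norm_le_norm_add_smul re_inner_covLaplacian_self_nonneg zero_le_one φ)
    (denseRange_covLaplacian_add_smul one_pos) hw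
  exact ⟨φ, hJ, hL.cauchySeq⟩

end Magnetic

/-! ### Schrödinger operators -/

theorem proposition2p1_general {m ħ κ B : ℝ} (hm : m ≠ 0) (hħ : ħ ≠ 0) {A : Plane → Plane}
    {V : Plane → ℝ} (hA : ∀ j, ContDiff ℝ 1 fun r => A r j)
    (ha : ∀ j, IsCb 1 fun r => A r j - uniformPotential B r j) (hV : IsLocallyL2 V)
    (hVu : IsUniformlyLocallyL2 V) :
    IsEssentiallySelfAdjoint (schrodinger m ħ κ A V hA hV) ∧
      (schrodinger m ħ κ A V hA hV).closure.domain = magneticSobolevTwo (κ * B / ħ) := by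
  have hAa (j : Fin 2) (r : Plane) : κ * A r j =
      ħ * uniformPotential (κ * B / ħ) r j + κ * (A r j - uniformPotential B r j) := by
    fin_cases j <;> simp [uniformPotential] <;> field_simp <;> ring
  have hc : ħ ^ 2 / (2 * m) ≠ 0 := by positivity
  have hbdd := isInfinitesimallyBounded_hamiltonianOnTest_sub (m := m) hAa
    (fun j => (ha j).const_mul κ) hA hV hVu
  have hesa : IsEssentiallySelfAdjoint (schrodinger m ħ κ A V hA hV) :=
    isSelfAdjoint_closure_of_isInfinitesimallyBounded re_inner_covLaplacian_self_nonneg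
      (schrodinger_graph hA hV) denseRange_testToL2 (hamiltonianOnTest_symmetric hA hV)
      (fun _ hl => denseRange_covLaplacian_add_smul hl) hc hbdd
  refine ⟨hesa, Submodule.ext fun ψ => ?_⟩
  rw [mem_closure_domain_iff_exists_seq (schrodinger_graph hA hV) hesa.1,
    mem_magneticSobolevTwo_iff]
  exact exists_congr fun φ => and_congr_right fun hφ =>
    cauchySeq_iff_of_isInfinitesimallyBounded (by exact_mod_cast hc) hbdd hφ.cauchySeq

lemma uniformPotential_zero (r : Plane) : uniformPotential 0 r = 0 := by
  ext j
  fin_cases j <;> simp [uniformPotential]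

section BlochLandau

variable {a b : Plane} {AΓ A₀ : Plane → Plane} {VΓ Φ : Plane → ℝ}

lemma InternalWeak.isUniformlyLocallyL2 (hab : 0 < wedge a b) (hΓ : InternalWeak a b AΓ VΓ) :
    IsUniformlyLocallyL2 VΓ :=
  isUniformlyLocallyL2_of_periodic hab hΓ.periodic_V
    (isLocallyL2_of_periodic hab hΓ.periodic_V hΓ.memLp_V)

lemma External.isUniformlyLocallyL2_const_mul (hE : External A₀ Φ) (q : ℝ) :
    IsUniformlyLocallyL2 fun r => q * Φ r := by
  obtain ⟨C, hC⟩ := (hE.cb_Φ.const_mul q).exists_norm_le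
  exact isUniformlyLocallyL2_of_bounded hC

lemma isUniformlyLocallyL2_total (hab : 0 < wedge a b) (hΓ : InternalWeak a b AΓ VΓ)
    (hE : External A₀ Φ) (q : ℝ) : IsUniformlyLocallyL2 fun r => VΓ r + q * Φ r :=
  (hΓ.isUniformlyLocallyL2 hab).add (hE.isUniformlyLocallyL2_const_mul q)
    (isLocallyL2_of_periodic hab hΓ.periodic_V hΓ.memLp_V).aestronglyMeasurable
    (continuous_const.mul hE.cb_Φ.1.continuous).aestronglyMeasurable

lemma isCb_total_sub_uniformPotential (hΓ : InternalWeak a b AΓ VΓ) (hE : External A₀ Φ) (B : ℝ)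
    (j : Fin 2) :
    IsCb 1 fun r => (AΓ r + (A₀ r + uniformPotential B r)) j - uniformPotential B r j := by
  simpa only [PiLp.add_apply, ← add_assoc, add_sub_cancel_right] using
    (hΓ.cb_A j).add ((hE.cb_A j).of_le le_top)

theorem isEssentiallySelfAdjoint_and_domain_periodicHamiltonian {m ħ : ℝ} (hm : m ≠ 0)
    (hħ : ħ ≠ 0) (q c : ℝ) (hab : 0 < wedge a b) (hΓ : InternalWeak a b AΓ VΓ) :
    IsEssentiallySelfAdjoint (periodicHamiltonian m ħ q c hab hΓ) ∧
      (periodicHamiltonian m ħ q c hab hΓ).closure.domain = sobolevTwo := by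
  have h := proposition2p1_general (κ := q / c) (B := 0) hm hħ
    (fun j => by exact_mod_cast (hΓ.cb_A j).1)
    (fun j => by simpa [uniformPotential_zero] using hΓ.cb_A j)
    (isLocallyL2_of_periodic hab hΓ.periodic_V hΓ.memLp_V) (hΓ.isUniformlyLocallyL2 hab)
  rwa [mul_zero, zero_div, magneticSobolevTwo, magneticD_zero] at h

theorem isEssentiallySelfAdjoint_and_domain_blochLandauHamiltonian {m ħ : ℝ} (hm : m ≠ 0)
    (hħ : ħ ≠ 0) (q c B : ℝ) (hab : 0 < wedge a b) (hΓ : InternalWeak a b AΓ VΓ)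
    (hE : External A₀ Φ) :
    IsEssentiallySelfAdjoint (blochLandauHamiltonian m ħ q c B hab hΓ hE) ∧
      (blochLandauHamiltonian m ħ q c B hab hΓ hE).closure.domain =
        magneticSobolevTwo (q * B / (c * ħ)) := by
  rw [← div_div, ← div_mul_eq_mul_div]
  exact proposition2p1_general hm hħ (contDiff_total B hΓ hE)
    (isCb_total_sub_uniformPotential hΓ hE B) _
    (isUniformlyLocallyL2_total hab hΓ hE q)

end BlochLandau

end BlochLandau

open BlochLandau in
theorem proposition2p1 (m ħ q c B : ℝ) (hm : 0 < m) (hħ : 0 < ħ) (hc : 0 < c)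
    (a b : Plane) (hab : 0 < wedge a b)
    (AΓ A₀ : Plane → Plane) (VΓ Φ : Plane → ℝ)
    (hΓ : InternalWeak a b AΓ VΓ) (hE : External A₀ Φ) :
    IsEssentiallySelfAdjoint (blochLandauHamiltonian m ħ q c B hab hΓ hE) ∧
    IsEssentiallySelfAdjoint (periodicHamiltonian m ħ q c hab hΓ) ∧
    (periodicHamiltonian m ħ q c hab hΓ).closure.domain = sobolevTwo ∧
    (blochLandauHamiltonian m ħ q c B hab hΓ hE).closure.domain =
      magneticSobolevTwo (q * B / (c * ħ)) := by
  have hBL :=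
    isEssentiallySelfAdjoint_and_domain_blochLandauHamiltonian hm.ne' hħ.ne' q c B hab hΓ hE
  have hper := isEssentiallySelfAdjoint_and_domain_periodicHamiltonian hm.ne' hħ.ne' q c hab hΓ
  exact ⟨hBL.1, hper.1, hper.2, hBL.2⟩
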